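/- Let $X_1,X_2,\dots$ be i.i.d. centered square-integrable random vectors in $\mathbb{R}^p$ with positive definite covariance matrix $C$, let $\varepsilon_1,\varepsilon_2,\dots$ be i.i.d. centered random variables with finite variance $\sigma^2>0$, and let the sequences $(X_i)$ and $(\varepsilon_i)$ be independent. Fix $\beta^0\in\mathbb{R}^p$ and put $y_i=X_i^T\beta^0+\varepsilon_i$. For $\lambda_1\ge\dots\ge\lambda_p\ge0$ let $J_\lambda(\beta)=\sum_{i=1}^p\lambda_i|\beta|_{(i)}$, where $|\beta|_{(1)}\ge\dots\ge|\beta|_{(p)}$ are the ordered absolute values of the coordinates of $\beta$. Let $\lambda^n$ be vectors with $\lambda^n_1\ge\dots\ge\lambda^n_p\ge0$ and $\lambda^n/\sqrt n\to\lambda$, and let the random vector $\hat\beta_n$ be a minimizer of $$\beta\mapsto\tfrac12\sum_{i=1}^n(y_i-X_i^T\beta)^2+J_{\lambda^n}(\beta).$$ Let $W\sim\mathcal N(0,\sigma^2C)$ and let $\hat u$ be the minimizer of $$V(u)=\tfrac12u^TCu-u^TW+J'_\lambda(\beta^0;u),\qquad J'_\lambda(\beta^0;u)=\lim_{t\downarrow0}\frac{J_\lambda(\beta^0+tu)-J_\lambda(\beta^0)}{t}.$$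 The pattern of $u\in\mathbb{R}^p$ is the vector $\mathbf{patt}(u)\in\mathbb{Z}^p$ with $\mathbf{patt}(u)_i=\mathrm{rank}(|u_i|)\,\mathrm{sgn}(u_i)$, where for $u_i\neq0$ $\mathrm{rank}(|u_i|)$ is the number of distinct nonzero values of $|u|$ that are at most $|u_i|$. Let $m$ be the number of distinct nonzero values of $|\beta^0|$, let $I_j=\{i:|\mathbf{patt}(\beta^0)_i|=j\}$, let $S$ be the diagonal matrix with $S_{ii}=\mathrm{sgn}(\beta^0_i)$ if $\beta^0_i\ne0$ and $S_{ii}=1$ otherwise, and let $U_{\beta^0}=S(\mathbf 1_{I_m}|\cdots|\mathbf 1_{I_1})$, with column span $\langle U_{\beta^0}\rangle$. Let $\Lambda_0=S\Pi\lambda$, where $\Pi$ is any permutation matrix such that $\Pi^T|\beta^0|$ is nonincreasing. Let $P=C^{1/2}U_{\beta^0}(U_{\beta^0}^TCU_{\beta^0})^{-1}U_{\beta^0}^TC^{1/2}$ and $$Z\sim\mathcal N\big(C^{1/2}PC^{-1/2}\Lambda_0,\ \sigma^2C^{1/2}(I-P)C^{1/2}\big).$$ Write $\partial J_\lambda(0)=\{v:\langle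 v,w\rangle\le J_\lambda(w)\ \text{for all } w\in\mathbb{R}^p\}$ for the subdifferential at $0$. Then $P$ is the orthogonal projection onto $C^{1/2}\langle U_{\beta^0}\rangle$, and $$\mathbb P\big[\mathbf{patt}(\hat\beta_n)=\mathbf{patt}(\beta^0)\big]\xrightarrow[n\to\infty]{}\mathbb P\big[\hat u\in\langle U_{\beta^0}\rangle\big]=\mathbb P\big[Z\in\partial J_\lambda(0)\big].$$ -/

import Mathlib

open MeasureTheory ProbabilityTheory Filter Topology
open scoped Matrix MatrixOrder RealInnerProductSpace

/-- The SLOPE penalty `J_l(u) = ∑ i, l i * |u|_(i)`, where `|u|_(1) ≥ |u|_(2) ≥ ...` are the absolute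
values of the coordinates of `u` in decreasing order. -/
noncomputable def slopeNorm {p : ℕ} (l : Fin p → ℝ) (u : EuclideanSpace ℝ (Fin p)) : ℝ :=
  ∑ i, l i * |u (Tuple.sort (fun j => -|u j|) i)|

/-- The directional derivative of `J_l` at `b` in the direction `u`, a one-sided derivative. -/
noncomputable def slopeDirDeriv {p : ℕ} (l : Fin p → ℝ) (b u : EuclideanSpace ℝ (Fin p)) : ℝ :=
  derivWithin (fun t : ℝ => slopeNorm l (b + t • u)) (Set.Ici 0) 0

/-- The subdifferential of a (convex) function `f` at the point `u`. -/
def subdifferential {p : ℕ} (f : EuclideanSpace ℝ (Fin p) → ℝ) (u : EuclideanSpace ℝ (Fin p)) :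
    Set (EuclideanSpace ℝ (Fin p)) :=
  {v | ∀ w, f u + ⟪v, w - u⟫ ≤ f w}

/-- The SLOPE objective `½ ‖y - Xβ‖² + J_l(β)` for `n` observations; `x i` is the `i`-th row of the
design matrix `X` and `y i` the `i`-th response. -/
noncomputable def slopeObjective {p : ℕ} (n : ℕ) (x : ℕ → EuclideanSpace ℝ (Fin p)) (y : ℕ → ℝ)
    (l : Fin p → ℝ) (β : EuclideanSpace ℝ (Fin p)) : ℝ :=
  1 / 2 * ∑ i ∈ Finset.range n, (y i - ⟪x i, β⟫) ^ 2 + slopeNorm l β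

/-- The limiting objective `V(u) = ½ uᵀCu - uᵀw + J'_l(b; u)`. -/
noncomputable def limitObjective {p : ℕ} (C : Matrix (Fin p) (Fin p) ℝ) (l : Fin p → ℝ)
    (b w u : EuclideanSpace ℝ (Fin p)) : ℝ :=
  1 / 2 * (u.ofLp ⬝ᵥ C *ᵥ u.ofLp) - ⟪u, w⟫ + slopeDirDeriv l b u

/-- The distinct nonzero values of `|u|`. -/
noncomputable def nonzeroLevels {p : ℕ} (u : EuclideanSpace ℝ (Fin p)) : Finset ℝ :=
  (Finset.univ.image fun i => |u i|).erase 0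

/-- The SLOPE pattern `patt(u)_i = rank(|u_i|) sgn(u_i)`; the smallest nonzero value of `|u|` has
rank one. -/
noncomputable def slopePattern {p : ℕ} (u : EuclideanSpace ℝ (Fin p)) : Fin p → ℤ := fun i =>
  (((nonzeroLevels u).filter fun x => x ≤ |u i|).card : ℤ) * (SignType.sign (u i) : ℤ)

/-- The diagonal sign matrix `S_u`, with entry `1` where `u` vanishes. -/
noncomputable def signMatrix {p : ℕ} (u : EuclideanSpace ℝ (Fin p)) : Matrix (Fin p) (Fin p) ℝ :=
  Matrix.diagonal fun i => if u i = 0 then 1 else (SignType.sign (u i) : ℝ)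

/-- The pattern matrix `U_u = S_u (1_{I_m} | ... | 1_{I_1})`, where `I_j` is the set of coordinates
at which `|patt(u)| = j` and `m` is the number of nonzero clusters. -/
noncomputable def patternMatrix {p : ℕ} (u : EuclideanSpace ℝ (Fin p)) :
    Matrix (Fin p) (Fin (nonzeroLevels u).card) ℝ :=
  signMatrix u * Matrix.of fun i k =>
    if |slopePattern u i| = ((k.rev : ℕ) : ℤ) + 1 then (1 : ℝ) else 0

/-- The column span `⟨U_u⟩` of the pattern matrix. -/
noncomputable def patternSpan {p : ℕ} (u : EuclideanSpace ℝ (Fin p)) :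
    Submodule ℝ (EuclideanSpace ℝ (Fin p)) :=
  Submodule.span ℝ (Set.range fun k => WithLp.toLp 2 ((patternMatrix u).col k))

/-- `Q` is a permutation matrix such that `Qᵀ|u|` is nonincreasing. -/
def IsSortingMatrix {p : ℕ} (Q : Matrix (Fin p) (Fin p) ℝ) (u : EuclideanSpace ℝ (Fin p)) : Prop :=
  (∃ τ : Equiv.Perm (Fin p), Q = τ.permMatrix ℝ) ∧ Antitone (Qᵀ *ᵥ fun i => |u i|)

/-- The positive semidefinite square root `C^{1/2}`. -/
noncomputable def matrixSqrt {p : ℕ} (C : Matrix (Fin p) (Fin p) ℝ) : Matrix (Fin p) (Fin p) ℝ :=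
  CFC.sqrt C

/-- The matrix `P = C^{1/2} U (Uᵀ C U)⁻¹ Uᵀ C^{1/2}`, with `U` the pattern matrix of `b`. -/
noncomputable def patternProjection {p : ℕ} (C : Matrix (Fin p) (Fin p) ℝ)
    (b : EuclideanSpace ℝ (Fin p)) : Matrix (Fin p) (Fin p) ℝ :=
  matrixSqrt C * patternMatrix b * ((patternMatrix b)ᵀ * C * patternMatrix b)⁻¹ *
    (patternMatrix b)ᵀ * matrixSqrt C

/-! The sorted norm is the maximum of the linear functionals `⟪signedPermVec τ s l, ·⟫`, and one
functional, given by a vector Λ, attains it at every vector with the pattern of `b = β₀`. In the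
coordinate `v = √n (β - b)` the objective is, up to a constant, a quadratic with matrix `c =
empiricalGram` and linear term `w = empiricalScore`, plus the sorted norm of `√n b + v` with weights
λⁿ/√n. With the penalty replaced by Λ, the minimizer over the pattern space is explicit, `v =
patternInv b c (w - Λ)`, and since `w / √n → 0` almost surely, `b + v / √n` has the pattern of `b`
for large `n`.

Once this holds, the estimator has the right pattern if and only if the residual `w - c v` lies in
the dual ball ∂J(0) (`samePattern_iff_slopeResidual_mem`). Necessity is the first-order condition.
Conversely, the residual agrees with Λ on the pattern space (`inner_slopeResidual`), so membership
makes it a subgradient at the candidate, and positive definiteness makes the candidate the only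
minimizer. The same argument with the directional derivative as penalty characterizes `û ∈ ⟨U⟩`
(`mem_patternSpan_iff_slopeResidual_mem`).

It remains to pass to the limit in the probability that the residual lies in the dual ball. That
ball is a polyhedron with one constraint per sign vector. Sign vectors in the pattern space give
constraints that always hold; the slacks of the others depend continuously on `w`, `c * patternInv b
c` and the weights, so they converge in law by the central limit theorem and Slutsky's lemma. Each
limiting slack is a nondegenerate Gaussian, hence the boundary is null and the portmanteau theorem
applies. The limiting residual is affine in `W` and has the law of `Z`. Convergence of the estimator
itself is never needed. -/

/-! ### The sorted norm as a maximum of linear functionals -/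

/-- The vector with entries `s i * l (τ⁻¹ i)`, obtained from `l` by a permutation and signs. -/
noncomputable def signedPermVec {p : ℕ} (τ : Equiv.Perm (Fin p)) (s l : Fin p → ℝ) :
    EuclideanSpace ℝ (Fin p) :=
  WithLp.toLp 2 fun i => s i * l (τ.symm i)

/-- `τ` sorts `|u|` decreasingly, and `s` is a vector of signs of `u`. -/
def Aligned {p : ℕ} (τ : Equiv.Perm (Fin p)) (s : Fin p → ℝ) (u : EuclideanSpace ℝ (Fin p)) :
    Prop :=
  Antitone (fun i => |u (τ i)|) ∧ ∀ i, s i * u i = |u i|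

section SlopeNorm

variable {p : ℕ} {l : Fin p → ℝ} {u v : EuclideanSpace ℝ (Fin p)} {τ : Equiv.Perm (Fin p)}
  {s : Fin p → ℝ}

lemma inner_signedPermVec (τ : Equiv.Perm (Fin p)) (s l : Fin p → ℝ)
    (u : EuclideanSpace ℝ (Fin p)) :
    ⟪signedPermVec τ s l, u⟫ = ∑ j, l j * (s (τ j) * u (τ j)) := by
  rw [PiLp.inner_apply, ← Equiv.sum_comp τ]
  refine Finset.sum_congr rfl fun i _ => ?_
  simp [signedPermVec]
  ring

lemma antitone_abs_sort (u : EuclideanSpace ℝ (Fin p)) :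
    Antitone fun i => |u (Tuple.sort (fun j => -|u j|) i)| := by
  intro i j hij
  have := Tuple.monotone_sort (fun j => -|u j|) hij
  simpa using this

/-- All nonincreasing arrangements of `|u|` coincide as sequences, so the way `Tuple.sort` breaks
ties is irrelevant. -/
lemma slopeNorm_eq_of_antitone (l : Fin p → ℝ) (h : Antitone fun i => |u (τ i)|) :
    slopeNorm l u = ∑ i, l i * |u (τ i)| := by
  have h' : Monotone ((fun j => -|u j|) ∘ τ) := fun _ _ hij => neg_le_neg (h hij)
  have := Tuple.comp_sort_eq_comp_iff_monotone.2 h'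
  refine Finset.sum_congr rfl fun i _ => ?_
  have := congrFun this i
  simp only [Function.comp_apply, neg_inj] at this
  rw [this]

/-- Rearrangement inequality: the sum is largest when weights and absolute values are sorted alike.
-/
lemma sum_mul_abs_perm_le_slopeNorm (hl : Antitone l) (u : EuclideanSpace ℝ (Fin p))
    (τ : Equiv.Perm (Fin p)) : ∑ i, l i * |u (τ i)| ≤ slopeNorm l u := by
  set ρ := Tuple.sort (fun j => -|u j|) with hρ
  have hm : Monovary l fun i => |u (ρ i)| :=
    Antitone.monovary hl (antitone_abs_sort u)
  have := hm.sum_mul_comp_perm_le_sum_mul (σ := τ.trans ρ.symm)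
  simpa [slopeNorm] using this

/-- Half of the maximum formula; `Aligned.slopeNorm_eq` is the case of equality. Allowing `|s i| ≤
1` instead of `±1` admits `sign 0 = 0`. -/
lemma inner_signedPermVec_le (hl : Antitone l) (hl0 : ∀ i, 0 ≤ l i) (hs : ∀ i, |s i| ≤ 1)
    (τ : Equiv.Perm (Fin p)) (u : EuclideanSpace ℝ (Fin p)) :
    ⟪signedPermVec τ s l, u⟫ ≤ slopeNorm l u := by
  rw [inner_signedPermVec]
  refine le_trans (Finset.sum_le_sum fun i _ => ?_) (sum_mul_abs_perm_le_slopeNorm hl u τ)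
  refine mul_le_mul_of_nonneg_left ?_ (hl0 i)
  calc s (τ i) * u (τ i) ≤ |s (τ i) * u (τ i)| := le_abs_self _
    _ = |s (τ i)| * |u (τ i)| := abs_mul _ _
    _ ≤ 1 * |u (τ i)| := by gcongr; exact hs _
    _ = |u (τ i)| := one_mul _

lemma Aligned.slopeNorm_eq (h : Aligned τ s u) (l : Fin p → ℝ) :
    slopeNorm l u = ⟪signedPermVec τ s l, u⟫ := by
  rw [slopeNorm_eq_of_antitone l h.1, inner_signedPermVec]
  simp [h.2]

lemma exists_aligned (u : EuclideanSpace ℝ (Fin p)) :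
    ∃ τ : Equiv.Perm (Fin p), Aligned τ (fun i => (SignType.sign (u i) : ℝ)) u :=
  ⟨_, antitone_abs_sort u, fun _ => sign_mul_self _⟩

lemma abs_coe_signType_le_one (a : SignType) : |(a : ℝ)| ≤ 1 := by
  cases a <;> simp

lemma slopeNorm_zero (l : Fin p → ℝ) : slopeNorm l 0 = 0 := by simp [slopeNorm]

lemma slopeNorm_smul (l : Fin p → ℝ) {c : ℝ} (hc : 0 ≤ c) (u : EuclideanSpace ℝ (Fin p)) :
    slopeNorm l (c • u) = c * slopeNorm l u := by
  have h : Antitone fun i => |(c • u) (Tuple.sort (fun j => -|u j|) i)| := fun i j hij => by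
    simpa [abs_mul] using mul_le_mul_of_nonneg_left (antitone_abs_sort u hij) (abs_nonneg c)
  rw [slopeNorm_eq_of_antitone l h, slopeNorm, Finset.mul_sum]
  refine Finset.sum_congr rfl fun i _ => ?_
  simp [abs_mul, abs_of_nonneg hc]
  ring

lemma slopeNorm_smul_left (c : ℝ) (l : Fin p → ℝ) (u : EuclideanSpace ℝ (Fin p)) :
    slopeNorm (c • l) u = c * slopeNorm l u := by
  simp [slopeNorm, Finset.mul_sum, mul_assoc]

lemma slopeNorm_add_le (hl : Antitone l) (hl0 : ∀ i, 0 ≤ l i) (u v : EuclideanSpace ℝ (Fin p)) :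
    slopeNorm l (u + v) ≤ slopeNorm l u + slopeNorm l v := by
  obtain ⟨τ, h⟩ := exists_aligned (u + v)
  rw [h.slopeNorm_eq, inner_add_right]
  exact add_le_add (inner_signedPermVec_le hl hl0 (fun _ => abs_coe_signType_le_one _) _ _)
    (inner_signedPermVec_le hl hl0 (fun _ => abs_coe_signType_le_one _) _ _)

lemma convexOn_slopeNorm (hl : Antitone l) (hl0 : ∀ i, 0 ≤ l i) :
    ConvexOn ℝ Set.univ (slopeNorm l) := by
  refine ⟨convex_univ, fun u _ v _ a b ha hb _ => ?_⟩
  refine (slopeNorm_add_le hl hl0 _ _).trans ?_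
  rw [slopeNorm_smul l ha, slopeNorm_smul l hb]
  rfl

lemma mem_subdifferential_slopeNorm_zero :
    v ∈ subdifferential (slopeNorm l) 0 ↔ ∀ w, ⟪v, w⟫ ≤ slopeNorm l w := by
  simp [subdifferential, slopeNorm_zero]

/-- The vector with the signs `t` as its entries. -/
noncomputable def signVec (t : Fin p → SignType) : EuclideanSpace ℝ (Fin p) :=
  WithLp.toLp 2 fun i => (t i : ℝ)

/-- The dual ball of the sorted norm is the polyhedron cut out by the sign vectors. -/
lemma mem_subdifferential_slopeNorm_zero_iff_signVec :
    v ∈ subdifferential (slopeNorm l) 0 ↔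
      ∀ t : Fin p → SignType, ⟪v, signVec t⟫ ≤ slopeNorm l (signVec t) := by
  rw [mem_subdifferential_slopeNorm_zero]
  refine ⟨fun h t => h _, fun h w => ?_⟩
  -- Induction on the size of the support of `w`.
  induction hn : (Finset.univ.filter fun i => w i ≠ 0).card using Nat.strong_induction_on
    generalizing w with
  | _ n ih =>
    rcases (Finset.univ.filter fun i => w i ≠ 0).eq_empty_or_nonempty with hempty | hne
    · have : w = 0 := by
        ext i
        by_contra hi
        have : i ∈ Finset.univ.filter fun i => w i ≠ 0 := by simpa using hi
        simp [hempty] at this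
      simp [this, slopeNorm_zero]
    obtain ⟨k, hk, hmin⟩ := Finset.exists_min_image _ (fun i => |w i|) hne
    have hk0 : w k ≠ 0 := by simpa using hk
    have hmin' : ∀ i, w i ≠ 0 → |w k| ≤ |w i| := fun i hi => hmin i (by simpa using hi)
    set t : Fin p → SignType := fun i => SignType.sign (w i) with ht
    -- Peel off the layer whose height is the smallest nonzero `|w i|`: no sign flips, the order is
    -- kept, and coordinate `k` leaves the support.
    set w' := w - |w k| • signVec t with hw'
    have hw'_apply : ∀ i, w' i = w i - |w k| * (SignType.sign (w i) : ℝ) := fun i => by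
      simp [hw', signVec, ht]
    have hw'_zero : ∀ i, w i = 0 → w' i = 0 := fun i hi => by simp [hw'_apply, hi]
    have hs' : ∀ i, (SignType.sign (w i) : ℝ) * w' i = |w' i| := fun i => by
      by_cases hi : w i = 0
      · simp [hw'_zero i hi]
      have := hmin' i hi
      rw [hw'_apply]
      rcases lt_or_gt_of_ne hi with h1 | h1
      · rw [abs_of_neg h1] at this
        have e : ((-1 : SignType) : ℝ) = -1 := by simp
        rw [sign_neg h1, e, abs_of_nonpos (a := w i - |w k| * (-1)) (by linarith)]
        ring
      · rw [abs_of_pos h1] at this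
        have e : ((1 : SignType) : ℝ) = 1 := by simp
        rw [sign_pos h1, e, abs_of_nonneg (a := w i - |w k| * 1) (by linarith)]
        ring
    have habs' : ∀ i, w i ≠ 0 → |w' i| = |w i| - |w k| := fun i hi => by
      rw [← hs', hw'_apply, mul_sub, sign_mul_self]
      have : (SignType.sign (w i) : ℝ) * SignType.sign (w i) = 1 := by
        rcases lt_or_gt_of_ne hi with h1 | h1
        · simp [sign_neg h1]
        · simp [sign_pos h1]
      linear_combination (-|w k|) * this
    obtain ⟨τ, hτ⟩ := exists_aligned w
    have hτ' : Aligned τ (fun i => (SignType.sign (w i) : ℝ)) w' := by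
      refine ⟨fun i j hij => ?_, hs'⟩
      have hle : |w (τ j)| ≤ |w (τ i)| := hτ.1 hij
      by_cases hj : w (τ j) = 0
      · simp [hw'_zero _ hj]
      have hi : w (τ i) ≠ 0 := fun hi => hj (by simpa [hi] using hle)
      simp only [habs' _ hi, habs' _ hj]
      linarith
    have hτt : Aligned τ (fun i => (SignType.sign (w i) : ℝ)) (signVec t) := by
      have h1 : ∀ i, w i ≠ 0 → |(signVec t) i| = 1 := fun i hi => by
        rcases lt_or_gt_of_ne hi with h1 | h1
        · simp [signVec, ht, sign_neg h1]
        · simp [signVec, ht, sign_pos h1]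
      have h2 : ∀ i, |(signVec t) i| ≤ 1 := fun i => abs_coe_signType_le_one _
      refine ⟨fun i j hij => ?_, fun i => ?_⟩
      · have hle : |w (τ j)| ≤ |w (τ i)| := hτ.1 hij
        by_cases hj : w (τ j) = 0
        · simp [signVec, ht, hj]
        have hi : w (τ i) ≠ 0 := fun hi => hj (by simpa [hi] using hle)
        simp only [h1 _ hi]
        exact h2 _
      · rcases lt_trichotomy (w i) 0 with h1 | h1 | h1
        · simp [signVec, ht, sign_neg h1]
        · simp [signVec, ht, h1]
        · simp [signVec, ht, sign_pos h1]
    have hcard : (Finset.univ.filter fun i => w' i ≠ 0).card < n := by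
      rw [← hn]
      refine Finset.card_lt_card ⟨fun i hi => ?_, fun hsub => ?_⟩
      · simp only [Finset.mem_filter, Finset.mem_univ, true_and] at hi ⊢
        exact fun h => hi (hw'_zero i h)
      · have := hsub hk
        simp only [Finset.mem_filter, Finset.mem_univ, true_and] at this
        exact this (abs_eq_zero.1 (by rw [habs' k hk0, sub_self]))
    have hw : w = w' + |w k| • signVec t := by simp [hw']
    -- `w`, `w'` and the sign vector share one alignment, so the sorted norm acts on all three as
    -- the same linear functional.
    have e1 : slopeNorm l w = slopeNorm l w' + |w k| * slopeNorm l (signVec t) := by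
      rw [hτ.slopeNorm_eq, hτ'.slopeNorm_eq, hτt.slopeNorm_eq, ← real_inner_smul_right,
        ← inner_add_right, ← hw]
    have e2 : ⟪v, w⟫ = ⟪v, w'⟫ + |w k| * ⟪v, signVec t⟫ := by
      rw [← real_inner_smul_right, ← inner_add_right, ← hw]
    rw [e1, e2]
    exact add_le_add (ih _ hcard w' rfl) (mul_le_mul_of_nonneg_left (h t) (abs_nonneg _))

lemma continuous_slopeNorm_left (u : EuclideanSpace ℝ (Fin p)) :
    Continuous fun l : Fin p → ℝ => slopeNorm l u := by
  unfold slopeNorm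
  fun_prop

end SlopeNorm

/-! ### Patterns -/

/-- `u` and `b` have the same signs, and their absolute values are ordered in the same way. -/
def SamePattern {p : ℕ} (b u : EuclideanSpace ℝ (Fin p)) : Prop :=
  (∀ i, SignType.sign (u i) = SignType.sign (b i)) ∧ ∀ i j, |u i| ≤ |u j| ↔ |b i| ≤ |b j|

/-- The number of distinct nonzero values of `|u|` that are at most `|u i|`. -/
noncomputable def levelRank {p : ℕ} (u : EuclideanSpace ℝ (Fin p)) (i : Fin p) : ℕ :=
  ((nonzeroLevels u).filter fun x => x ≤ |u i|).card

section Pattern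

variable {p : ℕ} {b u v : EuclideanSpace ℝ (Fin p)} {i j : Fin p}

lemma mem_nonzeroLevels {x : ℝ} : x ∈ nonzeroLevels u ↔ x ≠ 0 ∧ ∃ i, |u i| = x := by
  simp [nonzeroLevels]

lemma abs_mem_nonzeroLevels (hi : u i ≠ 0) : |u i| ∈ nonzeroLevels u :=
  mem_nonzeroLevels.2 ⟨abs_ne_zero.2 hi, i, rfl⟩

lemma levelRank_eq_zero (hi : u i = 0) : levelRank u i = 0 := by
  rw [levelRank, Finset.card_eq_zero, Finset.filter_eq_empty_iff]
  intro x hx hle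
  obtain ⟨hx0, j, rfl⟩ := mem_nonzeroLevels.1 hx
  rw [hi, abs_zero] at hle
  exact hx0 (le_antisymm hle (abs_nonneg _))

lemma levelRank_pos (hi : u i ≠ 0) : 0 < levelRank u i :=
  Finset.card_pos.2 ⟨|u i|, Finset.mem_filter.2 ⟨abs_mem_nonzeroLevels hi, le_rfl⟩⟩

lemma levelRank_le_card (u : EuclideanSpace ℝ (Fin p)) (i : Fin p) :
    levelRank u i ≤ (nonzeroLevels u).card := Finset.card_filter_le _ _

lemma levelRank_le_iff : levelRank u i ≤ levelRank u j ↔ |u i| ≤ |u j| := by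
  refine ⟨fun h => ?_, fun h => Finset.card_le_card fun x hx => ?_⟩
  · by_contra! hlt
    have hi : u i ≠ 0 := fun hi => by
      rw [hi, abs_zero] at hlt
      exact absurd (abs_nonneg _) (not_le.2 hlt)
    refine absurd h (not_le.2 (Finset.card_lt_card ⟨fun x hx => ?_, fun hsub => ?_⟩))
    · rw [Finset.mem_filter] at hx ⊢
      exact ⟨hx.1, hx.2.trans hlt.le⟩
    · have := hsub (Finset.mem_filter.2 ⟨abs_mem_nonzeroLevels hi, le_rfl⟩)
      exact absurd (Finset.mem_filter.1 this).2 (not_le.2 hlt)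
  · rw [Finset.mem_filter] at hx ⊢
    exact ⟨hx.1, hx.2.trans h⟩

lemma levelRank_eq_iff : levelRank u i = levelRank u j ↔ |u i| = |u j| := by
  rw [le_antisymm_iff, le_antisymm_iff, levelRank_le_iff, levelRank_le_iff]

lemma slopePattern_apply (u : EuclideanSpace ℝ (Fin p)) (i : Fin p) :
    slopePattern u i = (levelRank u i : ℤ) * (SignType.sign (u i) : ℤ) := rfl

lemma abs_slopePattern (u : EuclideanSpace ℝ (Fin p)) (i : Fin p) :
    |slopePattern u i| = levelRank u i := by
  rw [slopePattern_apply]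
  rcases lt_trichotomy (u i) 0 with h | h | h
  · simp [sign_neg h]
  · simp [h, levelRank_eq_zero h]
  · simp [sign_pos h]

lemma sign_slopePattern (u : EuclideanSpace ℝ (Fin p)) (i : Fin p) :
    SignType.sign (slopePattern u i) = SignType.sign (u i) := by
  rw [slopePattern_apply]
  rcases lt_trichotomy (u i) 0 with h | h | h
  · have := levelRank_pos h.ne
    rw [sign_neg h]
    exact sign_neg (by simpa using this)
  · simp [h]
  · have := levelRank_pos h.ne'
    rw [sign_pos h]
    exact sign_pos (by simpa using this)

lemma SamePattern.refl (b : EuclideanSpace ℝ (Fin p)) : SamePattern b b :=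
  ⟨fun _ => rfl, fun _ _ => Iff.rfl⟩

lemma SamePattern.symm (h : SamePattern b u) : SamePattern u b :=
  ⟨fun i => (h.1 i).symm, fun i j => (h.2 i j).symm⟩

lemma SamePattern.trans (h : SamePattern b u) (h' : SamePattern u v) : SamePattern b v :=
  ⟨fun i => (h'.1 i).trans (h.1 i), fun i j => (h'.2 i j).trans (h.2 i j)⟩

lemma SamePattern.smul (h : SamePattern b u) {c : ℝ} (hc : 0 < c) : SamePattern b (c • u) := by
  refine ⟨fun i => ?_, fun i j => ?_⟩
  · simp [sign_mul, sign_pos hc, h.1]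
  · simp only [PiLp.smul_apply, smul_eq_mul, abs_mul, abs_of_pos hc]
    rw [mul_le_mul_iff_right₀ hc, h.2]

lemma SamePattern.eq_zero_iff (h : SamePattern b u) : u i = 0 ↔ b i = 0 := by
  rw [← sign_eq_zero_iff, h.1, sign_eq_zero_iff]

lemma SamePattern.abs_eq_iff (h : SamePattern b u) : |u i| = |u j| ↔ |b i| = |b j| := by
  rw [le_antisymm_iff, le_antisymm_iff, h.2, h.2]

/-- On `s`, `f` factors through `g`. Used to compare numbers of levels. -/
lemma card_image_le_card_image {α β γ : Type*} [DecidableEq β] [DecidableEq γ] (s : Finset α)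
    (f : α → β) (g : α → γ) (h : ∀ x ∈ s, ∀ y ∈ s, g x = g y → f x = f y) :
    (s.image f).card ≤ (s.image g).card := by
  classical
  have hex : ∀ z ∈ s.image g, ∃ x ∈ s, g x = z := fun z hz => by simpa using hz
  rcases s.eq_empty_or_nonempty with rfl | ⟨x₀, _⟩
  · simp
  let φ : γ → β := fun z => if hz : z ∈ s.image g then f (hex z hz).choose else f x₀
  refine Finset.card_le_card_of_surjOn φ fun y hy => ?_
  obtain ⟨x, hx, rfl⟩ := Finset.mem_image.1 (Finset.mem_coe.1 hy)
  have hz : g x ∈ s.image g := Finset.mem_image_of_mem g hx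
  refine ⟨g x, Finset.mem_coe.2 hz, ?_⟩
  simp only [φ, dif_pos hz]
  exact h _ (hex _ hz).choose_spec.1 _ hx (hex _ hz).choose_spec.2

/-- Indexing by coordinates instead of values leaves only conditions that `SamePattern` transfers.
-/
lemma levelRank_eq_card_image (u : EuclideanSpace ℝ (Fin p)) (i : Fin p) :
    levelRank u i =
      ((Finset.univ.filter fun j => u j ≠ 0 ∧ |u j| ≤ |u i|).image fun j => |u j|).card := by
  rw [levelRank]
  congr 1
  ext x
  simp only [Finset.mem_filter, mem_nonzeroLevels, Finset.mem_image, Finset.mem_univ, true_and]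
  constructor
  · rintro ⟨⟨h0, j, rfl⟩, hle⟩
    exact ⟨j, ⟨abs_ne_zero.1 h0, hle⟩, rfl⟩
  · rintro ⟨j, ⟨h0, hle⟩, rfl⟩
    exact ⟨⟨abs_ne_zero.2 h0, j, rfl⟩, hle⟩

lemma SamePattern.levelRank_le (h : SamePattern b u) : levelRank u i ≤ levelRank b i := by
  rw [levelRank_eq_card_image, levelRank_eq_card_image]
  have : (Finset.univ.filter fun j => u j ≠ 0 ∧ |u j| ≤ |u i|) =
      Finset.univ.filter fun j => b j ≠ 0 ∧ |b j| ≤ |b i| := by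
    ext j
    simp [h.2, h.eq_zero_iff]
  rw [this]
  exact card_image_le_card_image _ _ _ fun x _ y _ hxy => h.abs_eq_iff.2 hxy

/-- Signs and ranks determine, and are determined by, the signs and the order of the absolute
values. Everything below works with this comparison form. -/
lemma slopePattern_eq_iff : slopePattern u = slopePattern b ↔ SamePattern b u := by
  refine ⟨fun h => ⟨fun i => ?_, fun i j => ?_⟩, fun h => funext fun i => ?_⟩
  · rw [← sign_slopePattern, h, sign_slopePattern]
  · have key : ∀ i, levelRank u i = levelRank b i := fun i => by
      have := abs_slopePattern u i
      rw [h, abs_slopePattern] at this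
      exact_mod_cast this.symm
    rw [← levelRank_le_iff, key, key, levelRank_le_iff]
  · rw [slopePattern_apply, slopePattern_apply, h.1,
      le_antisymm h.levelRank_le h.symm.levelRank_le]

/-- Ranks have no gaps: there are at least as many ranks as nonzero levels, all inside `Icc 1 m`.
Hence no column of the pattern matrix vanishes. -/
lemma exists_levelRank_eq {r : ℕ} (h1 : 1 ≤ r) (h2 : r ≤ (nonzeroLevels u).card) :
    ∃ i, levelRank u i = r := by
  have hsub : Finset.image (levelRank u) (Finset.univ.filter fun i => u i ≠ 0) ⊆
      Finset.Icc 1 (nonzeroLevels u).card := fun x hx => by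
    simp only [Finset.mem_image, Finset.mem_filter, Finset.mem_univ, true_and] at hx
    obtain ⟨i, hi, rfl⟩ := hx
    exact Finset.mem_Icc.2 ⟨levelRank_pos hi, levelRank_le_card u i⟩
  have hcard : (nonzeroLevels u).card ≤
      (Finset.image (levelRank u) (Finset.univ.filter fun i => u i ≠ 0)).card := by
    have : nonzeroLevels u = (Finset.univ.filter fun i => u i ≠ 0).image fun i => |u i| := by
      ext x
      simp only [mem_nonzeroLevels, Finset.mem_image, Finset.mem_filter, Finset.mem_univ, true_and]
      constructor
      · rintro ⟨h0, j, rfl⟩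
        exact ⟨j, abs_ne_zero.1 h0, rfl⟩
      · rintro ⟨j, h0, rfl⟩
        exact ⟨abs_ne_zero.2 h0, j, rfl⟩
    rw [this]
    exact card_image_le_card_image _ _ _ fun x _ y _ hxy => levelRank_eq_iff.1 hxy
  have := Finset.eq_of_subset_of_card_le hsub (by simpa using hcard)
  have hr : r ∈ Finset.Icc 1 (nonzeroLevels u).card := Finset.mem_Icc.2 ⟨h1, h2⟩
  rw [← this] at hr
  obtain ⟨i, -, hi⟩ := Finset.mem_image.1 hr
  exact ⟨i, hi⟩

/-- The entry `1` of the sign matrix at zero coordinates is harmless, since rank zero never equals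
`k.rev + 1`. The reversal reflects the column order `I_m, ..., I_1`. -/
lemma patternMatrix_apply (u : EuclideanSpace ℝ (Fin p)) (i : Fin p)
    (k : Fin (nonzeroLevels u).card) :
    patternMatrix u i k =
      if levelRank u i = (k.rev : ℕ) + 1 then (SignType.sign (u i) : ℝ) else 0 := by
  rw [patternMatrix, signMatrix, Matrix.diagonal_mul, Matrix.of_apply, abs_slopePattern]
  have : ((levelRank u i : ℤ) = ((k.rev : ℕ) : ℤ) + 1) ↔ levelRank u i = (k.rev : ℕ) + 1 := by
    exact_mod_cast Iff.rfl
  simp only [this]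
  by_cases hi : u i = 0
  · simp [hi, levelRank_eq_zero hi]
  · simp [hi]

lemma sign_mul_sign_of_ne {x : ℝ} (hx : x ≠ 0) : (SignType.sign x : ℝ) * SignType.sign x = 1 := by
  rcases lt_or_gt_of_ne hx with h1 | h1
  · simp [sign_neg h1]
  · simp [sign_pos h1]

lemma exists_levelRank_eq_rev (k : Fin (nonzeroLevels u).card) :
    ∃ i, levelRank u i = (k.rev : ℕ) + 1 :=
  exists_levelRank_eq (by omega) (by have := k.rev.2; omega)

lemma exists_rev_eq_levelRank (hi : u i ≠ 0) :
    ∃ k : Fin (nonzeroLevels u).card, levelRank u i = (k.rev : ℕ) + 1 := by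
  have h1 := levelRank_pos hi
  have h2 := levelRank_le_card u i
  refine ⟨(⟨levelRank u i - 1, by omega⟩ : Fin _).rev, ?_⟩
  rw [Fin.rev_rev]
  simp only
  omega

lemma ne_zero_of_levelRank {r : ℕ} (h : levelRank u i = r + 1) : u i ≠ 0 := fun hi => by
  rw [levelRank_eq_zero hi] at h
  omega

/-- Multiplication by the pattern matrix copies the coefficient of a cluster, with signs. -/
lemma patternMatrix_mulVec_apply {k : Fin (nonzeroLevels u).card}
    (hk : levelRank u i = (k.rev : ℕ) + 1) (c : Fin (nonzeroLevels u).card → ℝ) :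
    (patternMatrix u *ᵥ c) i = SignType.sign (u i) * c k := by
  rw [Matrix.mulVec, dotProduct, Finset.sum_eq_single k]
  · rw [patternMatrix_apply, if_pos hk]
  · intro k' _ hk'
    rw [patternMatrix_apply, if_neg, zero_mul]
    intro h
    apply hk'
    have : (k'.rev : ℕ) = k.rev := by omega
    exact Fin.rev_injective (Fin.ext this)
  · simp

lemma patternMatrix_mulVec_apply_of_eq_zero (hi : u i = 0)
    (c : Fin (nonzeroLevels u).card → ℝ) : (patternMatrix u *ᵥ c) i = 0 := by
  rw [Matrix.mulVec, dotProduct, Finset.sum_eq_zero]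
  intro k _
  rw [patternMatrix_apply, if_neg, zero_mul]
  rw [levelRank_eq_zero hi]
  omega

/-- Each coefficient can be read off, up to sign, at a coordinate of its cluster. This makes `Uᵀ c
U` positive definite when `c` is. -/
lemma patternMatrix_mulVec_injective (u : EuclideanSpace ℝ (Fin p)) :
    Function.Injective (patternMatrix u).mulVec := by
  intro c d hcd
  funext k
  obtain ⟨i, hi⟩ := exists_levelRank_eq_rev k
  have := congrFun hcd i
  rw [patternMatrix_mulVec_apply hi, patternMatrix_mulVec_apply hi] at this
  have h1 := sign_mul_sign_of_ne (ne_zero_of_levelRank hi)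
  calc c k = SignType.sign (u i) * (SignType.sign (u i) * c k) := by rw [← mul_assoc, h1, one_mul]
    _ = d k := by rw [this, ← mul_assoc, h1, one_mul]

lemma mem_patternSpan_iff_exists :
    v ∈ patternSpan u ↔ ∃ c, patternMatrix u *ᵥ c = v.ofLp := by
  rw [patternSpan, Submodule.mem_span_range_iff_exists_fun]
  refine exists_congr fun c => ?_
  have : (∑ k, c k • WithLp.toLp 2 ((patternMatrix u).col k)) =
      WithLp.toLp 2 (patternMatrix u *ᵥ c) := by
    ext i
    simp [Matrix.mulVec, dotProduct, mul_comm]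
  rw [this]
  constructor
  · rintro rfl
    rfl
  · intro h
    rw [h]

/-- Coordinate form of the span: zero off the support of `u`, and constant on each cluster after
correcting signs. -/
lemma mem_patternSpan_iff :
    v ∈ patternSpan u ↔ (∀ i, u i = 0 → v i = 0) ∧ ∀ i j, |u i| = |u j| →
      (SignType.sign (u i) : ℝ) * v i = SignType.sign (u j) * v j := by
  rw [mem_patternSpan_iff_exists]
  constructor
  · rintro ⟨c, hc⟩
    refine ⟨fun i hi => ?_, fun i j hij => ?_⟩
    · rw [← hc, patternMatrix_mulVec_apply_of_eq_zero hi]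
    · by_cases hi : u i = 0
      · have hj : u j = 0 := by rw [hi, abs_zero] at hij; exact abs_eq_zero.1 hij.symm
        simp [hi, hj]
      have hj : u j ≠ 0 := fun hj => hi (by rw [hj, abs_zero] at hij; exact abs_eq_zero.1 hij)
      obtain ⟨k, hk⟩ := exists_rev_eq_levelRank hi
      have hk' : levelRank u j = (k.rev : ℕ) + 1 := by rw [← hk, levelRank_eq_iff, hij]
      rw [← hc, patternMatrix_mulVec_apply hk, patternMatrix_mulVec_apply hk', ← mul_assoc,
        ← mul_assoc, sign_mul_sign_of_ne hi, sign_mul_sign_of_ne hj]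
  · rintro ⟨h0, h⟩
    choose r hr using fun k => exists_levelRank_eq_rev (u := u) k
    refine ⟨fun k => SignType.sign (u (r k)) * v (r k), funext fun i => ?_⟩
    by_cases hi : u i = 0
    · rw [patternMatrix_mulVec_apply_of_eq_zero hi, h0 i hi]
    obtain ⟨k, hk⟩ := exists_rev_eq_levelRank hi
    rw [patternMatrix_mulVec_apply hk, h (r k) i (levelRank_eq_iff.1 ((hr k).trans hk.symm)),
      ← mul_assoc, sign_mul_sign_of_ne hi, one_mul]

lemma SamePattern.mem_patternSpan (h : SamePattern b u) : u ∈ patternSpan b := by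
  refine mem_patternSpan_iff.2 ⟨fun i hi => h.eq_zero_iff.2 hi, fun i j hij => ?_⟩
  rw [← h.1, ← h.1, sign_mul_self, sign_mul_self, h.abs_eq_iff.2 hij]

lemma SamePattern.patternSpan_eq (h : SamePattern b u) : patternSpan u = patternSpan b := by
  ext v
  simp only [mem_patternSpan_iff, h.abs_eq_iff, h.eq_zero_iff, h.1]

/-- Near `u`, the vectors of the pattern space have the same pattern as `u`. -/
lemma eventually_samePattern (u : EuclideanSpace ℝ (Fin p)) :
    ∀ᶠ v in 𝓝 u, v ∈ patternSpan u → SamePattern u v := by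
  have hc : ∀ i, Continuous fun v : EuclideanSpace ℝ (Fin p) => v i := fun i => by fun_prop
  -- Nonzero signs and strict inequalities persist near `u`; zeros and ties are forced by membership
  -- in the span.
  have h1 : ∀ i, ∀ᶠ v : EuclideanSpace ℝ (Fin p) in 𝓝 u, u i ≠ 0 →
      SignType.sign (v i) = SignType.sign (u i) := fun i => by
    rcases lt_trichotomy (u i) 0 with h | h | h
    · filter_upwards [(hc i).continuousAt.eventually_lt_const h] with v hv _
      rw [sign_neg h, sign_neg hv]
    · simp [h]
    · filter_upwards [(hc i).continuousAt.eventually_const_lt h] with v hv _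
      rw [sign_pos h, sign_pos hv]
  have h2 : ∀ i j, ∀ᶠ v : EuclideanSpace ℝ (Fin p) in 𝓝 u, |u i| < |u j| → |v i| < |v j| :=
    fun i j => by
      by_cases h : |u i| < |u j|
      · filter_upwards [(hc i).abs.continuousAt.eventually_lt (hc j).abs.continuousAt h] with v hv _
        exact hv
      · simp [h]
  filter_upwards [eventually_all.2 h1, eventually_all.2 fun i => eventually_all.2 (h2 i)]
    with v hv1 hv2 hv
  obtain ⟨hz, he⟩ := mem_patternSpan_iff.1 hv
  have hsign : ∀ i, SignType.sign (v i) = SignType.sign (u i) := fun i => by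
    by_cases hi : u i = 0
    · simp [hi, hz i hi]
    · exact hv1 i hi
  refine ⟨hsign, fun i j => ⟨fun h => ?_, fun h => ?_⟩⟩
  · by_contra! hlt
    exact absurd h (not_le.2 (hv2 j i hlt))
  · rcases h.lt_or_eq with h | h
    · exact (hv2 i j h).le
    · have := he i j h
      rw [← hsign, ← hsign, sign_mul_self, sign_mul_self] at this
      exact this.le

/-- Consequently the sorted norm is affine in small `t`, of either sign, along directions of the
pattern space. -/
lemma SamePattern.eventually_add_smul (h : SamePattern b u) (hv : v ∈ patternSpan b) :
    ∀ᶠ t in 𝓝 (0 : ℝ), SamePattern b (u + t • v) := by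
  have hc : Tendsto (fun t : ℝ => u + t • v) (𝓝 0) (𝓝 u) := by
    have : Continuous fun t : ℝ => u + t • v := by fun_prop
    simpa using this.tendsto 0
  filter_upwards [hc.eventually (eventually_samePattern u)] with t ht
  refine h.trans (ht ?_)
  rw [h.patternSpan_eq]
  exact Submodule.add_mem _ h.mem_patternSpan (Submodule.smul_mem _ _ hv)

/-- The sign `s i` is forced where `b i ≠ 0` and irrelevant elsewhere, because `u` vanishes there
too. -/
lemma Aligned.of_samePattern {τ : Equiv.Perm (Fin p)} {s : Fin p → ℝ} (h : Aligned τ s b)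
    (hu : SamePattern b u) : Aligned τ s u := by
  refine ⟨fun i j hij => (hu.2 _ _).2 (h.1 hij), fun i => ?_⟩
  by_cases hi : b i = 0
  · simp [hu.eq_zero_iff.2 hi]
  have h2 := h.2 i
  rw [← sign_mul_self (b i)] at h2
  rw [mul_right_cancel₀ hi h2, ← hu.1, sign_mul_self]

/-- The vector `S Q l`, which is `Λ₀` in the main theorem, represents the sorted norm on the vectors
with the pattern of `b`. -/
lemma IsSortingMatrix.exists_aligned {Q : Matrix (Fin p) (Fin p) ℝ} (hQ : IsSortingMatrix Q b) :
    ∃ (τ : Equiv.Perm (Fin p)) (s : Fin p → ℝ), Aligned τ s b ∧ (∀ i, |s i| ≤ 1) ∧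
      ∀ l : Fin p → ℝ, WithLp.toLp 2 ((signMatrix b * Q) *ᵥ l) = signedPermVec τ s l := by
  obtain ⟨⟨ρ, rfl⟩, hanti⟩ := hQ
  refine ⟨ρ.symm, fun i => if b i = 0 then 1 else (SignType.sign (b i) : ℝ), ⟨?_, fun i => ?_⟩,
    fun i => ?_, fun l => ?_⟩
  · rw [Matrix.transpose_permMatrix, Matrix.permMatrix_mulVec] at hanti
    exact hanti
  · by_cases hi : b i = 0
    · simp [hi]
    · simp only [hi, if_false, sign_mul_self]
  · dsimp only
    split_ifs
    · simp
    · exact abs_coe_signType_le_one _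
  · ext i
    rw [← Matrix.mulVec_mulVec, Matrix.permMatrix_mulVec]
    simp [signMatrix, Matrix.mulVec_diagonal, signedPermVec]

lemma measurableSet_slopePattern_eq (b : EuclideanSpace ℝ (Fin p)) :
    MeasurableSet {u | slopePattern u = slopePattern b} := by
  have h1 : ∀ i, Measurable fun u : EuclideanSpace ℝ (Fin p) => u i := fun i => by fun_prop
  have hpos : ∀ i, MeasurableSet {u : EuclideanSpace ℝ (Fin p) | 0 < u i} := fun i =>
    measurableSet_lt measurable_const (h1 i)
  have hneg : ∀ i, MeasurableSet {u : EuclideanSpace ℝ (Fin p) | u i < 0} := fun i =>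
    measurableSet_lt (h1 i) measurable_const
  have key : {u | slopePattern u = slopePattern b} =
      (⋂ i, {u | SignType.sign (u i) = SignType.sign (b i)}) ∩
        ⋂ i, ⋂ j, {u | |u i| ≤ |u j| ↔ |b i| ≤ |b j|} := by
    ext u
    simp [slopePattern_eq_iff, SamePattern]
  rw [key]
  refine (MeasurableSet.iInter fun i => ?_).inter
    (MeasurableSet.iInter fun i => MeasurableSet.iInter fun j => ?_)
  · rcases lt_trichotomy (b i) 0 with h | h | h
    · simpa only [sign_neg h, sign_eq_neg_one_iff] using hneg i
    · simp only [h, sign_zero, sign_eq_zero_iff]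
      exact measurableSet_eq_fun (h1 i) measurable_const
    · simpa only [sign_pos h, sign_eq_one_iff] using hpos i
  · have hm : MeasurableSet {u : EuclideanSpace ℝ (Fin p) | |u i| ≤ |u j|} :=
      measurableSet_le (h1 i).abs (h1 j).abs
    by_cases h : |b i| ≤ |b j|
    · simpa only [h, iff_true] using hm
    · simp only [h, iff_false]
      exact hm.compl

end Pattern

/-! ### Optimality conditions -/

/-- The continuous linear map of a square matrix on Euclidean space. -/
noncomputable abbrev matCLM {p : ℕ} (c : Matrix (Fin p) (Fin p) ℝ) :
    EuclideanSpace ℝ (Fin p) →L[ℝ] EuclideanSpace ℝ (Fin p) :=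
  Matrix.toEuclideanCLM (𝕜 := ℝ) c

/-- The matrix `U (Uᵀ c U)⁻¹ Uᵀ`, with `U` the pattern matrix of `b`. -/
noncomputable def patternInv {p : ℕ} (b : EuclideanSpace ℝ (Fin p))
    (c : Matrix (Fin p) (Fin p) ℝ) : Matrix (Fin p) (Fin p) ℝ :=
  patternMatrix b * ((patternMatrix b)ᵀ * c * patternMatrix b)⁻¹ * (patternMatrix b)ᵀ

/-- The negative gradient `w - c u` of the quadratic part at the minimizer
`u = U (Uᵀ c U)⁻¹ Uᵀ (w - Λ)` of the problem restricted to the pattern space. -/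
noncomputable def slopeResidual {p : ℕ} (b : EuclideanSpace ℝ (Fin p))
    (c : Matrix (Fin p) (Fin p) ℝ) (Λ w : EuclideanSpace ℝ (Fin p)) : EuclideanSpace ℝ (Fin p) :=
  w - matCLM c (matCLM (patternInv b c) (w - Λ))

section Optimality

variable {p : ℕ} {b u v w Λ h : EuclideanSpace ℝ (Fin p)} {c : Matrix (Fin p) (Fin p) ℝ}
  {l : Fin p → ℝ}

lemma posDef_gram (b : EuclideanSpace ℝ (Fin p)) (hc : c.PosDef) :
    ((patternMatrix b)ᵀ * c * patternMatrix b).PosDef := by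
  have := hc.conjTranspose_mul_mul_same (patternMatrix_mulVec_injective b)
  rwa [Matrix.conjTranspose_eq_transpose_of_trivial] at this

lemma isUnit_det_gram (b : EuclideanSpace ℝ (Fin p)) (hc : c.PosDef) :
    IsUnit ((patternMatrix b)ᵀ * c * patternMatrix b).det :=
  (posDef_gram b hc).det_pos.ne'.isUnit

lemma matCLM_apply (c : Matrix (Fin p) (Fin p) ℝ) (u : EuclideanSpace ℝ (Fin p)) :
    matCLM c u = WithLp.toLp 2 (c *ᵥ u.ofLp) := rfl

lemma matCLM_mul_apply (c d : Matrix (Fin p) (Fin p) ℝ) (u : EuclideanSpace ℝ (Fin p)) :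
    matCLM (c * d) u = matCLM c (matCLM d u) := by
  simp [matCLM_apply, Matrix.mulVec_mulVec]

lemma inner_matCLM (c : Matrix (Fin p) (Fin p) ℝ) (u v : EuclideanSpace ℝ (Fin p)) :
    ⟪u, matCLM c v⟫ = ⟪matCLM cᵀ u, v⟫ := by
  rw [Matrix.inner_toEuclideanCLM, real_inner_comm, matCLM_apply,
    EuclideanSpace.inner_eq_star_dotProduct]
  simp [Matrix.dotProduct_mulVec, Matrix.mulVec_transpose]

lemma transpose_eq_of_posDef (hc : c.PosDef) : cᵀ = c := by
  have := hc.isHermitian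
  rwa [Matrix.IsHermitian, Matrix.conjTranspose_eq_transpose_of_trivial] at this

lemma inner_matCLM_self_pos (hc : c.PosDef) (hu : u ≠ 0) : 0 < ⟪u, matCLM c u⟫ := by
  rw [Matrix.inner_toEuclideanCLM]
  have := hc.dotProduct_mulVec_pos (x := u.ofLp) (fun h0 => hu (by ext i; simp [h0]))
  simpa using this

lemma matCLM_patternInv_mem (b : EuclideanSpace ℝ (Fin p)) (c : Matrix (Fin p) (Fin p) ℝ)
    (v : EuclideanSpace ℝ (Fin p)) : matCLM (patternInv b c) v ∈ patternSpan b := by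
  rw [mem_patternSpan_iff_exists]
  refine ⟨((patternMatrix b)ᵀ * c * patternMatrix b)⁻¹ *ᵥ ((patternMatrix b)ᵀ *ᵥ v.ofLp), ?_⟩
  simp [matCLM_apply, patternInv, Matrix.mulVec_mulVec, Matrix.mul_assoc]

lemma forall_inner_patternSpan_iff :
    (∀ h ∈ patternSpan b, ⟪v, h⟫ = 0) ↔ (patternMatrix b)ᵀ *ᵥ v.ofLp = 0 := by
  have key : ∀ c, ⟪v, WithLp.toLp 2 (patternMatrix b *ᵥ c)⟫ =
      ((patternMatrix b)ᵀ *ᵥ v.ofLp) ⬝ᵥ c := fun c => by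
    rw [EuclideanSpace.inner_eq_star_dotProduct]
    simp [Matrix.mulVec_transpose, dotProduct_comm, Matrix.dotProduct_mulVec]
  constructor
  · intro hv
    -- Test against the vector of the span with coefficients `Uᵀ v`.
    refine dotProduct_self_eq_zero.1 ?_
    rw [← key]
    exact hv _ (mem_patternSpan_iff_exists.2 ⟨_, rfl⟩)
  · intro hv h hh
    obtain ⟨c, hc⟩ := mem_patternSpan_iff_exists.1 hh
    have : h = WithLp.toLp 2 (patternMatrix b *ᵥ c) := by rw [hc]
    rw [this, key, hv, zero_dotProduct]

lemma matCLM_patternInv_eq_zero (c : Matrix (Fin p) (Fin p) ℝ)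
    (hv : ∀ h ∈ patternSpan b, ⟪v, h⟫ = 0) : matCLM (patternInv b c) v = 0 := by
  rw [forall_inner_patternSpan_iff] at hv
  rw [matCLM_apply, patternInv, ← Matrix.mulVec_mulVec, hv, Matrix.mulVec_zero]
  rfl

lemma matCLM_patternInv_apply (hc : c.PosDef) (hu : u ∈ patternSpan b) :
    matCLM (patternInv b c) (matCLM c u) = u := by
  obtain ⟨d, hd⟩ := mem_patternSpan_iff_exists.1 hu
  have : u = WithLp.toLp 2 (patternMatrix b *ᵥ d) := by rw [hd]
  rw [this, ← matCLM_mul_apply, matCLM_apply, patternInv]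
  simp only [Matrix.mulVec_mulVec]
  rw [show patternMatrix b * ((patternMatrix b)ᵀ * c * patternMatrix b)⁻¹ * (patternMatrix b)ᵀ * c *
      patternMatrix b = patternMatrix b * (((patternMatrix b)ᵀ * c * patternMatrix b)⁻¹ *
        ((patternMatrix b)ᵀ * c * patternMatrix b)) by simp only [Matrix.mul_assoc],
    Matrix.nonsing_inv_mul _ (isUnit_det_gram b hc), Matrix.mul_one]

lemma transpose_mul_mul_patternInv (hc : c.PosDef) :
    (patternMatrix b)ᵀ * (c * patternInv b c) = (patternMatrix b)ᵀ := by
  rw [patternInv, show (patternMatrix b)ᵀ * (c * (patternMatrix b *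
      ((patternMatrix b)ᵀ * c * patternMatrix b)⁻¹ * (patternMatrix b)ᵀ)) =
      ((patternMatrix b)ᵀ * c * patternMatrix b) *
        ((patternMatrix b)ᵀ * c * patternMatrix b)⁻¹ * (patternMatrix b)ᵀ by
      simp only [Matrix.mul_assoc],
    Matrix.mul_nonsing_inv _ (isUnit_det_gram b hc), Matrix.one_mul]

/-- Normal equation of the problem restricted to the pattern space: `Uᵀ c U (Uᵀ c U)⁻¹ Uᵀ = Uᵀ`. -/
lemma inner_slopeResidual (hc : c.PosDef) (Λ w : EuclideanSpace ℝ (Fin p))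
    (hh : h ∈ patternSpan b) : ⟪slopeResidual b c Λ w, h⟫ = ⟪Λ, h⟫ := by
  have : ⟪slopeResidual b c Λ w - Λ, h⟫ = 0 := by
    refine forall_inner_patternSpan_iff.2 ?_ h hh
    have h1 : slopeResidual b c Λ w - Λ =
        (w - Λ) - matCLM (c * patternInv b c) (w - Λ) := by
      rw [slopeResidual, matCLM_mul_apply]
      abel
    rw [h1, matCLM_apply, WithLp.ofLp_sub, Matrix.mulVec_sub, Matrix.mulVec_mulVec,
      transpose_mul_mul_patternInv hc, sub_self]
  rw [inner_sub_left] at this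
  linarith

lemma quadratic_add (hc : cᵀ = c) (u h : EuclideanSpace ℝ (Fin p)) :
    ⟪u + h, matCLM c (u + h)⟫ = ⟪u, matCLM c u⟫ + 2 * ⟪matCLM c u, h⟫ + ⟪h, matCLM c h⟫ := by
  have h1 : ⟪u, matCLM c h⟫ = ⟪matCLM c u, h⟫ := by rw [inner_matCLM, hc]
  rw [map_add, inner_add_left, inner_add_right, inner_add_right, h1,
    real_inner_comm (matCLM c u) h]
  ring

/-- The first-order condition at a minimizer of a quadratic function plus `φ`. -/
lemma inner_sub_le_of_isMin {φ : EuclideanSpace ℝ (Fin p) → ℝ} (hc : cᵀ = c) {a : ℝ}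
    (hmin : ∀ v, 1 / 2 * ⟪u, matCLM c u⟫ - ⟪u, w⟫ + φ u ≤ 1 / 2 * ⟪v, matCLM c v⟫ - ⟪v, w⟫ + φ v)
    (hφ : ∀ᶠ t in 𝓝[>] (0 : ℝ), φ (u + t • h) ≤ φ u + t * a) :
    ⟪w - matCLM c u, h⟫ ≤ a := by
  -- After division by `t`, the second-order term of the quadratic contributes only `t / 2 * ⟪h, c
  -- h⟫`.
  have hlim : Tendsto (fun t : ℝ => a + t * (1 / 2 * ⟪h, matCLM c h⟫)) (𝓝[>] 0) (𝓝 a) := by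
    have : Continuous fun t : ℝ => a + t * (1 / 2 * ⟪h, matCLM c h⟫) := by fun_prop
    have := (this.tendsto 0).mono_left (nhdsWithin_le_nhds (s := Set.Ioi 0))
    simpa using this
  refine ge_of_tendsto hlim ?_
  filter_upwards [hφ, self_mem_nhdsWithin] with t ht ht0
  have ht0 : 0 < t := ht0
  have := hmin (u + t • h)
  rw [quadratic_add hc, map_smul, inner_smul_right, inner_smul_left, inner_smul_right,
    inner_add_left, inner_smul_left] at this
  simp only [RCLike.conj_to_real] at this
  rw [inner_sub_left, real_inner_comm h w]
  refine le_of_mul_le_mul_left ?_ ht0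
  nlinarith

/-- A quadratic function plus `φ` has at most one minimizer, and a point at which the negative
gradient of the quadratic part is a subgradient of `φ` is the minimizer. -/
lemma eq_of_isMin_of_subgradient {φ : EuclideanSpace ℝ (Fin p) → ℝ} (hc : c.PosDef)
    (hmin : ∀ v, 1 / 2 * ⟪u, matCLM c u⟫ - ⟪u, w⟫ + φ u ≤ 1 / 2 * ⟪v, matCLM c v⟫ - ⟪v, w⟫ + φ v)
    (hφ : φ v + ⟪w - matCLM c v, u - v⟫ ≤ φ u) : u = v := by
  by_contra hne
  have hpos := inner_matCLM_self_pos hc (sub_ne_zero.2 hne)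
  have h1 := hmin v
  -- Expanding around `v`, the subgradient inequality makes the objective at `u` exceed that at `v`
  -- by at least `½ ⟪u - v, c (u - v)⟫ > 0`.
  have h2 := quadratic_add (transpose_eq_of_posDef hc) v (u - v)
  rw [add_sub_cancel] at h2
  rw [h2] at h1
  rw [inner_sub_left, inner_sub_right w, real_inner_comm u w, real_inner_comm v w] at hφ
  linarith

/-- A vector of the pattern space which satisfies the optimality conditions on that space is given
by the explicit formula. -/
lemma eq_patternInv_of_inner_eq (hc : c.PosDef) (hu : u ∈ patternSpan b)
    (h : ∀ h ∈ patternSpan b, ⟪w - matCLM c u, h⟫ = ⟪Λ, h⟫) :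
    u = matCLM (patternInv b c) (w - Λ) := by
  have h0 : matCLM (patternInv b c) (w - matCLM c u - Λ) = 0 :=
    matCLM_patternInv_eq_zero c fun g hg => by rw [inner_sub_left, h g hg, sub_self]
  have h1 : w - Λ = matCLM c u + (w - matCLM c u - Λ) := by abel
  rw [h1, map_add, matCLM_patternInv_apply hc hu, h0, add_zero]

/-- The minimizer of a quadratic function plus `φ` lies in the pattern space only if the residual
is in the dual ball. -/
lemma slopeResidual_mem_of_isMin {φ : EuclideanSpace ℝ (Fin p) → ℝ} (hc : c.PosDef)
    (hmin : ∀ v, 1 / 2 * ⟪u, matCLM c u⟫ - ⟪u, w⟫ + φ u ≤ 1 / 2 * ⟪v, matCLM c v⟫ - ⟪v, w⟫ + φ v)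
    (hu : u ∈ patternSpan b)
    (h1 : ∀ h, ∀ᶠ t in 𝓝[>] (0 : ℝ), φ (u + t • h) ≤ φ u + t * slopeNorm l h)
    (h2 : ∀ h ∈ patternSpan b, ∀ᶠ t in 𝓝[>] (0 : ℝ), φ (u + t • h) ≤ φ u + t * ⟪Λ, h⟫) :
    slopeResidual b c Λ w ∈ subdifferential (slopeNorm l) 0 := by
  have hsym := transpose_eq_of_posDef hc
  -- On the pattern space both `h` and `-h` are admissible, so the first-order inequality is an
  -- equality.
  have heq : ∀ h ∈ patternSpan b, ⟪w - matCLM c u, h⟫ = ⟪Λ, h⟫ := fun h hh => by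
    refine le_antisymm (inner_sub_le_of_isMin hsym hmin (h2 h hh)) ?_
    have := inner_sub_le_of_isMin hsym hmin (h2 (-h) (Submodule.neg_mem _ hh))
    rw [inner_neg_right, inner_neg_right] at this
    linarith
  rw [slopeResidual, ← eq_patternInv_of_inner_eq hc hu heq, mem_subdifferential_slopeNorm_zero]
  exact fun h => inner_sub_le_of_isMin hsym hmin (h1 h)

section Aligned

variable {τ : Equiv.Perm (Fin p)} {s : Fin p → ℝ}

lemma Aligned.slopeNorm_eq_of_samePattern (hb : Aligned τ s b) (hu : SamePattern b u)
    (l : Fin p → ℝ) : slopeNorm l u = ⟪signedPermVec τ s l, u⟫ :=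
  (hb.of_samePattern hu).slopeNorm_eq l

/-- The pattern of the minimizer of a penalized quadratic function. -/
lemma samePattern_iff_slopeResidual_mem (hb : Aligned τ s b) (hl : Antitone l)
    (hl0 : ∀ i, 0 ≤ l i) (hc : c.PosDef) {b' : EuclideanSpace ℝ (Fin p)} (hb' : SamePattern b b')
    (hmin : ∀ v, 1 / 2 * ⟪u, matCLM c u⟫ - ⟪u, w⟫ + slopeNorm l (b' + u) ≤
      1 / 2 * ⟪v, matCLM c v⟫ - ⟪v, w⟫ + slopeNorm l (b' + v))
    (hsmall : SamePattern b (b' + matCLM (patternInv b c) (w - signedPermVec τ s l))) :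
    SamePattern b (b' + u) ↔
      slopeResidual b c (signedPermVec τ s l) w ∈ subdifferential (slopeNorm l) 0 := by
  constructor
  · intro hu
    have hmem : u ∈ patternSpan b := by
      have := Submodule.sub_mem _ hu.mem_patternSpan hb'.mem_patternSpan
      rwa [add_sub_cancel_left] at this
    refine slopeResidual_mem_of_isMin (φ := fun v => slopeNorm l (b' + v)) hc hmin hmem
      (fun h => ?_) fun h hh => ?_
    · filter_upwards [self_mem_nhdsWithin] with t ht
      rw [← slopeNorm_smul l (le_of_lt ht), ← add_assoc]
      exact slopeNorm_add_le hl hl0 _ _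
    · filter_upwards [nhdsWithin_le_nhds (hu.eventually_add_smul hh)] with t ht
      rw [← add_assoc, hb.slopeNorm_eq_of_samePattern ht, hb.slopeNorm_eq_of_samePattern hu,
        inner_add_right _ _ (t • h), real_inner_smul_right]
  · intro hmem
    rw [eq_of_isMin_of_subgradient (φ := fun v => slopeNorm l (b' + v)) hc hmin ?_]
    · exact hsmall
    -- The residual represents the norm at the candidate, where it pairs like Λ, and lies below it
    -- elsewhere, so it is a subgradient there.
    rw [← slopeResidual, hb.slopeNorm_eq_of_samePattern hsmall,
      ← inner_slopeResidual hc _ w hsmall.mem_patternSpan, ← inner_add_right]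
    refine le_trans (le_of_eq ?_) (mem_subdifferential_slopeNorm_zero.1 hmem _)
    congr 1
    abel

/-- Convexity along the line guarantees one-sided differentiability, so `derivWithin` is a genuine
limit of quotients and not its default value. -/
lemma tendsto_slopeDirDeriv (hl : Antitone l) (hl0 : ∀ i, 0 ≤ l i)
    (b u : EuclideanSpace ℝ (Fin p)) :
    Tendsto (fun t : ℝ => t⁻¹ * (slopeNorm l (b + t • u) - slopeNorm l b)) (𝓝[>] 0)
      (𝓝 (slopeDirDeriv l b u)) := by
  have hconv : ConvexOn ℝ Set.univ fun t : ℝ => slopeNorm l (b + t • u) := by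
    refine ⟨convex_univ, fun x _ y _ r q hr hq hrq => ?_⟩
    have := (convexOn_slopeNorm hl hl0).2 (Set.mem_univ (b + x • u)) (Set.mem_univ (b + y • u))
      hr hq hrq
    refine le_trans (le_of_eq ?_) this
    rw [smul_add, smul_add, add_add_add_comm, ← add_smul, hrq, one_smul, smul_smul, smul_smul,
      ← add_smul, smul_eq_mul, smul_eq_mul]
  have hdiff := hconv.differentiableWithinAt_Ioi_of_mem_interior (x := 0) (by simp)
  have hder : HasDerivWithinAt (fun t : ℝ => slopeNorm l (b + t • u)) (slopeDirDeriv l b u)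
      (Set.Ioi 0) 0 := by
    rw [slopeDirDeriv, ← derivWithin_Ioi_eq_Ici]
    exact hdiff.hasDerivWithinAt
  rw [hasDerivWithinAt_iff_tendsto_slope' (by simp)] at hder
  refine hder.congr fun t => ?_
  simp [slope_def_module]

/-- For small `t > 0` the pattern does not change, so the difference quotient is constant. -/
lemma Aligned.slopeDirDeriv_eq (hb : Aligned τ s b) (hl : Antitone l) (hl0 : ∀ i, 0 ≤ l i)
    (hu : u ∈ patternSpan b) : slopeDirDeriv l b u = ⟪signedPermVec τ s l, u⟫ := by
  refine tendsto_nhds_unique (tendsto_slopeDirDeriv hl hl0 b u) (tendsto_const_nhds.congr' ?_)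
  filter_upwards [nhdsWithin_le_nhds ((SamePattern.refl b).eventually_add_smul hu),
    self_mem_nhdsWithin] with t ht ht0
  have ht0 : 0 < t := ht0
  rw [hb.slopeNorm_eq_of_samePattern ht, hb.slopeNorm_eq l, inner_add_right, real_inner_smul_right]
  field_simp
  ring

lemma Aligned.slopeDirDeriv_add_le (hb : Aligned τ s b) (hl : Antitone l) (hl0 : ∀ i, 0 ≤ l i)
    (hu : u ∈ patternSpan b) (h : EuclideanSpace ℝ (Fin p)) :
    slopeDirDeriv l b (u + h) ≤ ⟪signedPermVec τ s l, u⟫ + slopeNorm l h := by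
  refine le_of_tendsto (tendsto_slopeDirDeriv hl hl0 b (u + h)) ?_
  filter_upwards [nhdsWithin_le_nhds ((SamePattern.refl b).eventually_add_smul hu),
    self_mem_nhdsWithin] with t ht ht0
  have ht0 : 0 < t := ht0
  have h1 := slopeNorm_add_le hl hl0 (b + t • u) (t • h)
  rw [add_assoc, ← smul_add, slopeNorm_smul l ht0.le, hb.slopeNorm_eq_of_samePattern ht,
    inner_add_right, ← hb.slopeNorm_eq l, real_inner_smul_right] at h1
  rw [inv_mul_le_iff₀ ht0]
  linarith

/-- A point of the dual ball attaining the norm at `b` is a subgradient at `b`, hence bounds every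
difference quotient from below. -/
lemma inner_le_slopeDirDeriv (hl : Antitone l) (hl0 : ∀ i, 0 ≤ l i)
    (hv : v ∈ subdifferential (slopeNorm l) 0) (hvb : ⟪v, b⟫ = slopeNorm l b)
    (u : EuclideanSpace ℝ (Fin p)) : ⟪v, u⟫ ≤ slopeDirDeriv l b u := by
  refine ge_of_tendsto (tendsto_slopeDirDeriv hl hl0 b u) ?_
  filter_upwards [self_mem_nhdsWithin] with t ht0
  have ht0 : 0 < t := ht0
  have h1 := mem_subdifferential_slopeNorm_zero.1 hv (b + t • u)
  rw [inner_add_right, hvb, real_inner_smul_right] at h1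
  rw [le_inv_mul_iff₀ ht0]
  linarith

/-- The minimizer of the limiting objective lies in the pattern space if and only if the residual
is in the dual ball. -/
lemma mem_patternSpan_iff_slopeResidual_mem (hb : Aligned τ s b) (hl : Antitone l)
    (hl0 : ∀ i, 0 ≤ l i) (hc : c.PosDef) (hmin : IsMinOn (limitObjective c l b w) Set.univ u) :
    u ∈ patternSpan b ↔
      slopeResidual b c (signedPermVec τ s l) w ∈ subdifferential (slopeNorm l) 0 := by
  have hmin' : ∀ v, 1 / 2 * ⟪u, matCLM c u⟫ - ⟪u, w⟫ + slopeDirDeriv l b u ≤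
      1 / 2 * ⟪v, matCLM c v⟫ - ⟪v, w⟫ + slopeDirDeriv l b v := fun v => by
    simp only [Matrix.inner_toEuclideanCLM]
    exact hmin (Set.mem_univ v)
  constructor
  · intro hu
    refine slopeResidual_mem_of_isMin hc hmin' hu (fun h => ?_) fun h hh => ?_
    · filter_upwards [self_mem_nhdsWithin] with t ht
      rw [hb.slopeDirDeriv_eq hl hl0 hu, ← slopeNorm_smul l (le_of_lt ht)]
      exact hb.slopeDirDeriv_add_le hl hl0 hu _
    · refine Eventually.of_forall fun t => le_of_eq ?_
      rw [hb.slopeDirDeriv_eq hl hl0 hu, hb.slopeDirDeriv_eq hl hl0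
        (Submodule.add_mem _ hu (Submodule.smul_mem _ t hh)), inner_add_right,
        real_inner_smul_right]
  · intro hmem
    have hmemH := matCLM_patternInv_mem b c (w - signedPermVec τ s l)
    rw [eq_of_isMin_of_subgradient hc hmin' (v := matCLM (patternInv b c)
      (w - signedPermVec τ s l)) ?_]
    · exact hmemH
    rw [← slopeResidual, hb.slopeDirDeriv_eq hl hl0 hmemH, ← inner_slopeResidual hc _ w hmemH,
      ← inner_add_right, add_sub_cancel]
    refine inner_le_slopeDirDeriv hl hl0 hmem ?_ u
    rw [inner_slopeResidual hc _ w (SamePattern.refl b).mem_patternSpan, hb.slopeNorm_eq]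

end Aligned

end Optimality

/-! ### Independence of pairs and the multivariate central limit theorem -/

section Probability

variable {Ω Ω' : Type*} {mΩ : MeasurableSpace Ω} {mΩ' : MeasurableSpace Ω'} {μ : Measure Ω}
  {ν : Measure Ω'}

/-- Rectangles form a generating π-system. On them, independence of the two sequences separates the
events, independence within each factors them, and independence of each pair recombines the factors.
-/
lemma iIndepFun_prodMk_of_measurable {ι E F : Type*} {mE : MeasurableSpace E}
    {mF : MeasurableSpace F} {X : ι → Ω → E} {Y : ι → Ω → F} (hX : ∀ i, Measurable (X i))
    (hY : ∀ i, Measurable (Y i)) (hXi : iIndepFun X μ) (hYi : iIndepFun Y μ)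
    (hXY : IndepFun (fun ω i => X i ω) (fun ω i => Y i ω) μ) :
    iIndepFun (fun i ω => (X i ω, Y i ω)) μ := by
  rw [iIndepFun_iff_iIndep]
  refine iIndepSets.iIndep (fun i => ((hX i).prodMk (hY i)).comap_le)
    (fun i => {s | ∃ t ∈ Set.image2 (fun x1 x2 => x1 ×ˢ x2) {s : Set E | MeasurableSet s}
      {t : Set F | MeasurableSet t}, (fun ω => (X i ω, Y i ω)) ⁻¹' t = s})
    (fun i => isPiSystem_prod.comap _) (fun i => ?_) ?_
  · rw [← generateFrom_prod, MeasurableSpace.comap_generateFrom]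
    rfl
  rw [iIndepSets_iff]
  intro s f hf
  have hex : ∀ i, ∃ (A : Set E) (B : Set F), MeasurableSet A ∧ MeasurableSet B ∧
      (i ∈ s → f i = X i ⁻¹' A ∩ Y i ⁻¹' B) := fun i => by
    by_cases hi : i ∈ s
    · obtain ⟨t, ⟨A, hA, B, hB, rfl⟩, ht⟩ := hf i hi
      exact ⟨A, B, hA, hB, fun _ => ht.symm⟩
    · exact ⟨∅, ∅, MeasurableSet.empty, MeasurableSet.empty, fun h => absurd h hi⟩
  choose A B hA hB hAB using hex
  have h1 : ⋂ i ∈ s, f i =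
      ((fun ω i => X i ω) ⁻¹' ⋂ i ∈ s, (fun x => x i) ⁻¹' A i) ∩
        ((fun ω i => Y i ω) ⁻¹' ⋂ i ∈ s, (fun x => x i) ⁻¹' B i) := by
    ext ω
    simp only [Set.mem_iInter, Set.mem_inter_iff, Set.mem_preimage]
    constructor
    · intro h
      refine ⟨fun i hi => ?_, fun i hi => ?_⟩
      · have := h i hi
        rw [hAB i hi] at this
        exact this.1
      · have := h i hi
        rw [hAB i hi] at this
        exact this.2
    · intro h i hi
      rw [hAB i hi]
      exact ⟨h.1 i hi, h.2 i hi⟩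
  have h2 : ∀ i ∈ s, μ (f i) = μ (X i ⁻¹' A i) * μ (Y i ⁻¹' B i) := fun i hi => by
    have hi2 : IndepFun (X i) (Y i) μ :=
      hXY.comp (measurable_pi_apply i) (measurable_pi_apply i)
    rw [hAB i hi, hi2.measure_inter_preimage_eq_mul _ _ (hA i) (hB i)]
  rw [h1, hXY.measure_inter_preimage_eq_mul _ _
    (Finset.measurableSet_biInter s fun i _ => measurable_pi_apply i (hA i))
    (Finset.measurableSet_biInter s fun i _ => measurable_pi_apply i (hB i)),
    Finset.prod_congr rfl h2, Finset.prod_mul_distrib]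
  congr 1
  · rw [← hXi.measure_inter_preimage_eq_mul s fun i _ => hA i]
    simp only [Set.preimage_iInter]
    rfl
  · rw [← hYi.measure_inter_preimage_eq_mul s fun i _ => hB i]
    simp only [Set.preimage_iInter]
    rfl

/-- Two independent sequences of independent random variables form a sequence of independent
pairs. -/
lemma iIndepFun_prodMk_of_indepFun {ι E F : Type*} [Countable ι] {mE : MeasurableSpace E}
    {mF : MeasurableSpace F} {X : ι → Ω → E} {Y : ι → Ω → F} (hX : ∀ i, AEMeasurable (X i) μ)
    (hY : ∀ i, AEMeasurable (Y i) μ) (hXi : iIndepFun X μ) (hYi : iIndepFun Y μ)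
    (hXY : IndepFun (fun ω i => X i ω) (fun ω i => Y i ω) μ) :
    iIndepFun (fun i ω => (X i ω, Y i ω)) μ := by
  -- Pass to measurable versions; countability of `ι` makes whole sequences agree almost surely.
  have hXm := fun i => (hX i).ae_eq_mk
  have hYm := fun i => (hY i).ae_eq_mk
  have key := iIndepFun_prodMk_of_measurable (fun i => (hX i).measurable_mk)
    (fun i => (hY i).measurable_mk) ((iIndepFun_congr hXm).1 hXi) ((iIndepFun_congr hYm).1 hYi)
    (hXY.congr (by filter_upwards [ae_all_iff.2 hXm] with ω h using funext h)
      (by filter_upwards [ae_all_iff.2 hYm] with ω h using funext h))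
  refine (iIndepFun_congr fun i => ?_).1 key
  filter_upwards [hXm i, hYm i] with ω h1 h2
  rw [h1, h2]

variable {p : ℕ}

lemma memLp_inner_left [IsProbabilityMeasure μ] {X : Ω → EuclideanSpace ℝ (Fin p)}
    (hX : MemLp X 2 μ) (t : EuclideanSpace ℝ (Fin p)) : MemLp (fun ω => ⟪t, X ω⟫) 2 μ :=
  (innerSL ℝ t).comp_memLp' hX

/-- The law of a linear functional of a Gaussian vector. -/
lemma hasLaw_inner_of_multivariateGaussian {W : Ω → EuclideanSpace ℝ (Fin p)}
    {m : EuclideanSpace ℝ (Fin p)} {S : Matrix (Fin p) (Fin p) ℝ} (hS : S.PosSemidef)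
    (hW : HasLaw W (multivariateGaussian m S) μ) (t : EuclideanSpace ℝ (Fin p)) :
    HasLaw (fun ω => ⟪t, W ω⟫) (gaussianReal ⟪t, m⟫ (t.ofLp ⬝ᵥ S *ᵥ t.ofLp).toNNReal) μ := by
  have h1 : HasLaw (fun x : EuclideanSpace ℝ (Fin p) => ⟪t, x⟫)
      (gaussianReal ⟪t, m⟫ (t.ofLp ⬝ᵥ S *ᵥ t.ofLp).toNNReal) (multivariateGaussian m S) := by
    refine ⟨by fun_prop, ?_⟩
    have h2 := IsGaussian.map_eq_gaussianReal (μ := multivariateGaussian m S) (innerSL ℝ t)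
    have h3 : Var[innerSL ℝ t; multivariateGaussian m S] = t.ofLp ⬝ᵥ S *ᵥ t.ofLp := by
      rw [← covarianceBilin_multivariateGaussian (μ := m) hS, covarianceBilin_apply_eq_cov
        IsGaussian.memLp_two_id, covariance_self (by fun_prop)]
      rfl
    rw [h3, (innerSL ℝ t).integral_comp_id_comm IsGaussian.integrable_id,
      integral_id_multivariateGaussian] at h2
    exact h2
  exact h1.comp hW

/-- Cramér–Wold device: characteristic functions reduce to those of one-dimensional projections at
frequency one. -/
lemma charFun_map_inner {Y : Ω → EuclideanSpace ℝ (Fin p)} (hY : AEMeasurable Y μ)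
    (t : EuclideanSpace ℝ (Fin p)) :
    charFun (μ.map Y) t = charFun (μ.map fun ω => ⟪t, Y ω⟫) 1 := by
  rw [charFun_apply, charFun_apply, integral_map hY (by fun_prop),
    integral_map (by fun_prop) (by fun_prop)]
  simp [real_inner_comm]

lemma aemeasurable_smul_sum {ξ : ℕ → Ω → EuclideanSpace ℝ (Fin p)}
    (hξ : ∀ i, AEMeasurable (ξ i) μ) (c : ℝ) (n : ℕ) :
    AEMeasurable (fun ω => c • ∑ i ∈ Finset.range n, ξ i ω) μ := by
  have : AEMeasurable (fun ω => ∑ i ∈ Finset.range n, ξ i ω) μ :=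
    Finset.aemeasurable_fun_sum _ fun i _ => hξ i
  exact this.const_smul c

/-- The multivariate central limit theorem. -/
theorem tendstoInDistribution_inv_sqrt_smul_sum [IsProbabilityMeasure μ] [IsProbabilityMeasure ν]
    {ξ : ℕ → Ω → EuclideanSpace ℝ (Fin p)} {W : Ω' → EuclideanSpace ℝ (Fin p)}
    {S : Matrix (Fin p) (Fin p) ℝ} (hS : S.PosSemidef)
    (hW : HasLaw W (multivariateGaussian 0 S) ν) (hξ : MemLp (ξ 0) 2 μ) (h0 : ∫ ω, ξ 0 ω ∂μ = 0)
    (hvar : ∀ t, Var[fun ω => ⟪t, ξ 0 ω⟫; μ] = t.ofLp ⬝ᵥ S *ᵥ t.ofLp)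
    (hindep : iIndepFun ξ μ) (hident : ∀ i, IdentDistrib (ξ i) (ξ 0) μ μ) :
    TendstoInDistribution (fun (n : ℕ) ω => (√(n : ℝ))⁻¹ • ∑ i ∈ Finset.range n, ξ i ω) atTop W
      (fun _ => μ) ν where
  forall_aemeasurable n := aemeasurable_smul_sum (fun i => (hident i).aemeasurable_fst) _ n
  aemeasurable_limit := hW.aemeasurable
  tendsto := by
    refine ProbabilityMeasure.tendsto_iff_tendsto_charFun.2 fun t => ?_
    have hclt := tendstoInDistribution_inv_sqrt_mul_sum_sub
      (X := fun i ω => ⟪t, ξ i ω⟫) (P := μ) (P' := ν) (Y := fun ω => ⟪t, W ω⟫) ?_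
      (memLp_inner_left hξ t) (hindep.comp (fun _ x => ⟪t, x⟫) fun _ => by fun_prop)
      (fun i => (hident i).comp (u := fun x => ⟪t, x⟫) (by fun_prop))
    · have hc := ProbabilityMeasure.tendsto_iff_tendsto_charFun.1 hclt.tendsto 1
      have hmean : ∫ ω, ⟪t, ξ 0 ω⟫ ∂μ = 0 := by
        rw [integral_inner (hξ.integrable (by norm_num)), h0, inner_zero_right]
      simp only [ProbabilityMeasure.coe_mk, hmean, mul_zero, sub_zero] at hc ⊢
      rw [charFun_map_inner hW.aemeasurable]
      refine hc.congr fun n => ?_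
      rw [charFun_map_inner (aemeasurable_smul_sum (fun i => (hident i).aemeasurable_fst) _ n)]
      simp only [real_inner_smul_right, inner_sum]
    · have := hasLaw_inner_of_multivariateGaussian hS hW t
      rwa [inner_zero_right, ← hvar t] at this

/-- The variance of a linear functional is given by the covariance matrix. -/
lemma variance_inner_eq [IsProbabilityMeasure μ] {X : Ω → EuclideanSpace ℝ (Fin p)}
    {C : Matrix (Fin p) (Fin p) ℝ} (hX : MemLp X 2 μ)
    (hC : ∀ a b, covariance (fun ω => X ω a) (fun ω => X ω b) μ = C a b)
    (t : EuclideanSpace ℝ (Fin p)) :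
    Var[fun ω => ⟪t, X ω⟫; μ] = t.ofLp ⬝ᵥ C *ᵥ t.ofLp := by
  have hcoord : ∀ a, MemLp (fun ω => X ω a) 2 μ := fun a =>
    (EuclideanSpace.proj (𝕜 := ℝ) a).comp_memLp' hX
  have h1 : (fun ω => ⟪t, X ω⟫) = fun ω => ∑ a, t a * X ω a := by
    funext ω
    simp [PiLp.inner_apply, mul_comm]
  rw [h1, variance_fun_sum' fun a _ => (hcoord a).const_mul _]
  simp only [covariance_const_mul_left, covariance_const_mul_right, hC, dotProduct, Matrix.mulVec,
    Finset.mul_sum]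
  refine Finset.sum_congr rfl fun a _ => Finset.sum_congr rfl fun b _ => ?_
  ring

section Product

variable {X : Ω → EuclideanSpace ℝ (Fin p)} {ε : Ω → ℝ}

/-- By independence `|ε|² ‖X‖²` is integrable from second moments alone. -/
lemma memLp_smul_of_indepFun (hX : MemLp X 2 μ) (hε : MemLp ε 2 μ) (h : IndepFun X ε μ) :
    MemLp (fun ω => ε ω • X ω) 2 μ := by
  have hm : AEStronglyMeasurable (fun ω => ε ω • X ω) μ := hε.1.smul hX.1
  rw [memLp_two_iff_integrable_sq_norm hm]
  have h1 := (memLp_two_iff_integrable_sq_norm hX.1).1 hX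
  have h2 := (memLp_two_iff_integrable_sq_norm hε.1).1 hε
  have hind : IndepFun (fun ω => ‖ε ω‖ ^ 2) (fun ω => ‖X ω‖ ^ 2) μ :=
    h.symm.comp (φ := fun x : ℝ => ‖x‖ ^ 2) (ψ := fun x : EuclideanSpace ℝ (Fin p) => ‖x‖ ^ 2)
      (by fun_prop) (by fun_prop)
  refine (hind.integrable_mul h2 h1).congr (Eventually.of_forall fun ω => ?_)
  simp [norm_smul, mul_pow]

lemma integral_smul_eq_zero_of_indepFun [IsProbabilityMeasure μ] (hX : MemLp X 2 μ)
    (hε : MemLp ε 2 μ) (h : IndepFun X ε μ) (h0 : ∫ ω, ε ω ∂μ = 0) : ∫ ω, ε ω • X ω ∂μ = 0 := by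
  have hint := (memLp_smul_of_indepFun hX hε h).integrable (by norm_num)
  refine ext_inner_left ℝ fun t => ?_
  rw [← integral_inner hint, inner_zero_right]
  have hind : IndepFun ε (fun ω => ⟪t, X ω⟫) μ :=
    h.symm.comp (φ := id) (ψ := fun x => ⟪t, x⟫) measurable_id (by fun_prop)
  have := hind.integral_mul_eq_mul_integral hε.1 (memLp_inner_left hX t).1
  rw [h0, zero_mul] at this
  simpa [real_inner_smul_right] using this

lemma variance_inner_smul_of_indepFun [IsProbabilityMeasure μ] {C : Matrix (Fin p) (Fin p) ℝ}
    {σ : ℝ} (hX : MemLp X 2 μ)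
    (hX0 : ∫ ω, X ω ∂μ = 0) (hε : MemLp ε 2 μ) (h : IndepFun X ε μ) (h0 : ∫ ω, ε ω ∂μ = 0)
    (hC : ∀ a b, covariance (fun ω => X ω a) (fun ω => X ω b) μ = C a b)
    (hσ : Var[ε; μ] = σ ^ 2) (t : EuclideanSpace ℝ (Fin p)) :
    Var[fun ω => ⟪t, ε ω • X ω⟫; μ] = t.ofLp ⬝ᵥ (σ ^ 2 • C) *ᵥ t.ofLp := by
  have hint := (memLp_smul_of_indepFun hX hε h).integrable (by norm_num)
  have hm : ∫ ω, ⟪t, ε ω • X ω⟫ ∂μ = 0 := by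
    rw [integral_inner hint, integral_smul_eq_zero_of_indepFun hX hε h h0, inner_zero_right]
  have hmX : ∫ ω, ⟪t, X ω⟫ ∂μ = 0 := by
    rw [integral_inner (hX.integrable (by norm_num)), hX0, inner_zero_right]
  have hVX := variance_inner_eq hX hC t
  rw [variance_of_integral_eq_zero (memLp_inner_left hX t).1.aemeasurable hmX] at hVX
  rw [variance_of_integral_eq_zero hε.1.aemeasurable h0] at hσ
  rw [variance_of_integral_eq_zero
    (memLp_inner_left (memLp_smul_of_indepFun hX hε h) t).1.aemeasurable hm]
  have hind : IndepFun (fun ω => ε ω ^ 2) (fun ω => ⟪t, X ω⟫ ^ 2) μ :=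
    h.symm.comp (φ := fun x : ℝ => x ^ 2) (ψ := fun x => ⟪t, x⟫ ^ 2) (by fun_prop) (by fun_prop)
  have := hind.integral_mul_eq_mul_integral (hε.1.pow 2) ((memLp_inner_left hX t).1.pow 2)
  rw [hσ, hVX] at this
  rw [Matrix.smul_mulVec, dotProduct_smul, smul_eq_mul, ← this]
  refine integral_congr_ae (Eventually.of_forall fun ω => ?_)
  simp [real_inner_smul_right, mul_pow]

end Product

end Probability

/-! ### The estimator at a fixed sample size -/

/-- The empirical second moment matrix `n⁻¹ ∑ x_i x_iᵀ`. -/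
noncomputable def empiricalGram {p : ℕ} (n : ℕ) (x : ℕ → EuclideanSpace ℝ (Fin p)) :
    Matrix (Fin p) (Fin p) ℝ :=
  (n : ℝ)⁻¹ • ∑ i ∈ Finset.range n, Matrix.vecMulVec (x i).ofLp (x i).ofLp

/-- The normalized score `n^{-1/2} ∑ e_i x_i`. -/
noncomputable def empiricalScore {p : ℕ} (n : ℕ) (x : ℕ → EuclideanSpace ℝ (Fin p)) (e : ℕ → ℝ) :
    EuclideanSpace ℝ (Fin p) :=
  (√(n : ℝ))⁻¹ • ∑ i ∈ Finset.range n, e i • x i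

section Sample

variable {p n : ℕ} {x : ℕ → EuclideanSpace ℝ (Fin p)} {y e : ℕ → ℝ}
  {b u v : EuclideanSpace ℝ (Fin p)} {lam l s : Fin p → ℝ} {τ : Equiv.Perm (Fin p)}

lemma empiricalGram_apply (n : ℕ) (x : ℕ → EuclideanSpace ℝ (Fin p)) (i j : Fin p) :
    empiricalGram n x i j = (∑ k ∈ Finset.range n, x k i * x k j) / n := by
  simp [empiricalGram, Matrix.sum_apply, Matrix.vecMulVec_apply, div_eq_inv_mul]

lemma transpose_empiricalGram (n : ℕ) (x : ℕ → EuclideanSpace ℝ (Fin p)) :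
    (empiricalGram n x)ᵀ = empiricalGram n x := by
  ext i j
  simp [empiricalGram_apply, mul_comm]

lemma matCLM_empiricalGram (n : ℕ) (x : ℕ → EuclideanSpace ℝ (Fin p))
    (v : EuclideanSpace ℝ (Fin p)) :
    matCLM (empiricalGram n x) v = (n : ℝ)⁻¹ • ∑ i ∈ Finset.range n, ⟪x i, v⟫ • x i := by
  ext j
  simp only [matCLM_apply, Matrix.mulVec, dotProduct, empiricalGram_apply, PiLp.smul_apply,
    WithLp.ofLp_sum, Finset.sum_apply, PiLp.inner_apply, smul_eq_mul, Finset.sum_div,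
    Finset.sum_mul, Finset.mul_sum]
  rw [Finset.sum_comm]
  refine Finset.sum_congr rfl fun i _ => ?_
  refine Finset.sum_congr rfl fun k _ => ?_
  simp only [RCLike.inner_apply, conj_trivial]
  ring

lemma inner_empiricalGram (n : ℕ) (x : ℕ → EuclideanSpace ℝ (Fin p))
    (v : EuclideanSpace ℝ (Fin p)) :
    ⟪v, matCLM (empiricalGram n x) v⟫ = (n : ℝ)⁻¹ * ∑ i ∈ Finset.range n, ⟪x i, v⟫ ^ 2 := by
  rw [matCLM_empiricalGram, real_inner_smul_right, inner_sum]
  congr 1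
  refine Finset.sum_congr rfl fun i _ => ?_
  rw [real_inner_smul_right, real_inner_comm, sq]

/-- The objective in the local coordinate `v = √n (β - b)`. -/
lemma slopeObjective_add_smul (hn : n ≠ 0) (hy : ∀ i, y i = ⟪x i, b⟫ + e i) (lam : Fin p → ℝ)
    (v : EuclideanSpace ℝ (Fin p)) :
    slopeObjective n x y lam (b + (√(n : ℝ))⁻¹ • v) =
      1 / 2 * ∑ i ∈ Finset.range n, e i ^ 2 +
        (1 / 2 * ⟪v, matCLM (empiricalGram n x) v⟫ - ⟪v, empiricalScore n x e⟫ +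
          slopeNorm ((√(n : ℝ))⁻¹ • lam) (√(n : ℝ) • b + v)) := by
  have hn0 : (0 : ℝ) < √(n : ℝ) := Real.sqrt_pos.2 (by positivity)
  have hsq : (√(n : ℝ))⁻¹ ^ 2 = (n : ℝ)⁻¹ := by rw [inv_pow, Real.sq_sqrt (by positivity)]
  have hJ : slopeNorm ((√(n : ℝ))⁻¹ • lam) (√(n : ℝ) • b + v) =
      slopeNorm lam (b + (√(n : ℝ))⁻¹ • v) := by
    have : √(n : ℝ) • b + v = √(n : ℝ) • (b + (√(n : ℝ))⁻¹ • v) := by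
      rw [smul_add, smul_smul, mul_inv_cancel₀ hn0.ne', one_smul]
    rw [this, slopeNorm_smul _ hn0.le, slopeNorm_smul_left, ← mul_assoc, mul_inv_cancel₀ hn0.ne',
      one_mul]
  have hsum : ∑ i ∈ Finset.range n, (y i - ⟪x i, b + (√(n : ℝ))⁻¹ • v⟫) ^ 2 =
      ∑ i ∈ Finset.range n, e i ^ 2 - 2 * ((√(n : ℝ))⁻¹ * ∑ i ∈ Finset.range n, e i * ⟪x i, v⟫) +
        (n : ℝ)⁻¹ * ∑ i ∈ Finset.range n, ⟪x i, v⟫ ^ 2 := by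
    rw [← hsq, Finset.mul_sum, Finset.mul_sum, Finset.mul_sum, ← Finset.sum_sub_distrib,
      ← Finset.sum_add_distrib]
    refine Finset.sum_congr rfl fun i _ => ?_
    rw [hy, inner_add_right, real_inner_smul_right]
    ring
  have hscore : ⟪v, empiricalScore n x e⟫ =
      (√(n : ℝ))⁻¹ * ∑ i ∈ Finset.range n, e i * ⟪x i, v⟫ := by
    rw [empiricalScore, real_inner_smul_right, inner_sum]
    congr 1
    refine Finset.sum_congr rfl fun i _ => ?_
    rw [real_inner_smul_right, real_inner_comm]
  rw [slopeObjective, hsum, hscore, hJ, inner_empiricalGram]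
  ring

/-- For a nondegenerate sample, and if the minimizer over the pattern space has the right pattern,
the estimator recovers the pattern if and only if the residual is in the dual ball. -/
lemma samePattern_estimator_iff (hn : n ≠ 0) (hy : ∀ i, y i = ⟪x i, b⟫ + e i)
    (hmin : IsMinOn (slopeObjective n x y lam) Set.univ u) (hb : Aligned τ s b)
    (hl : Antitone ((√(n : ℝ))⁻¹ • lam)) (hl0 : ∀ i, 0 ≤ ((√(n : ℝ))⁻¹ • lam) i)
    (hc : (empiricalGram n x).PosDef)
    (hsmall : SamePattern b (b + (√(n : ℝ))⁻¹ • matCLM (patternInv b (empiricalGram n x))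
      (empiricalScore n x e - signedPermVec τ s ((√(n : ℝ))⁻¹ • lam)))) :
    SamePattern b u ↔
      slopeResidual b (empiricalGram n x) (signedPermVec τ s ((√(n : ℝ))⁻¹ • lam))
        (empiricalScore n x e) ∈ subdifferential (slopeNorm ((√(n : ℝ))⁻¹ • lam)) 0 := by
  have hn0 : (0 : ℝ) < √(n : ℝ) := Real.sqrt_pos.2 (by positivity)
  have hscale : ∀ v : EuclideanSpace ℝ (Fin p),
      √(n : ℝ) • (b + (√(n : ℝ))⁻¹ • v) = √(n : ℝ) • b + v := fun v => by
    rw [smul_add, smul_smul, mul_inv_cancel₀ hn0.ne', one_smul]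
  have hu : b + (√(n : ℝ))⁻¹ • (√(n : ℝ) • (u - b)) = u := by
    rw [smul_smul, inv_mul_cancel₀ hn0.ne', one_smul, add_sub_cancel]
  have hsmall' := hsmall.smul hn0
  rw [hscale] at hsmall'
  -- Patterns are invariant under positive scaling, so `b + v / √n` may be replaced by `√n b + v`.
  rw [← samePattern_iff_slopeResidual_mem hb hl hl0 hc ((SamePattern.refl b).smul hn0)
    (u := √(n : ℝ) • (u - b)) (fun v => ?_) hsmall']
  · have : √(n : ℝ) • b + √(n : ℝ) • (u - b) = √(n : ℝ) • u := by
      rw [← smul_add, add_sub_cancel]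
    rw [this]
    refine ⟨fun h => h.smul hn0, fun h => ?_⟩
    have := h.smul (inv_pos.2 hn0)
    rwa [smul_smul, inv_mul_cancel₀ hn0.ne', one_smul] at this
  · have h1 := hmin (Set.mem_univ (b + (√(n : ℝ))⁻¹ • v))
    rw [Set.mem_ofPred_eq, slopeObjective_add_smul hn hy] at h1
    have h2 := slopeObjective_add_smul (x := x) hn hy lam (√(n : ℝ) • (u - b))
    rw [hu] at h2
    linarith

end Sample

/-! ### Limits -/

section Limits

variable {p : ℕ} {b : EuclideanSpace ℝ (Fin p)} {C : Matrix (Fin p) (Fin p) ℝ}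
  {τ : Equiv.Perm (Fin p)} {s l : Fin p → ℝ}

lemma Continuous.matCLM_apply {α : Type*} [TopologicalSpace α] {f : α → Matrix (Fin p) (Fin p) ℝ}
    {g : α → EuclideanSpace ℝ (Fin p)} (hf : Continuous f) (hg : Continuous g) :
    Continuous fun a => matCLM (f a) (g a) := by
  have h : Continuous fun a => f a *ᵥ (g a).ofLp :=
    hf.matrix_mulVec ((PiLp.continuous_ofLp 2 _).comp hg)
  exact (PiLp.continuous_toLp 2 _).comp h

lemma posDef_of_forall_inner_pos {c : Matrix (Fin p) (Fin p) ℝ} (hc : cᵀ = c)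
    (h : ∀ u ∈ Metric.sphere (0 : EuclideanSpace ℝ (Fin p)) 1, 0 < ⟪u, matCLM c u⟫) :
    c.PosDef := by
  refine Matrix.PosDef.of_dotProduct_mulVec_pos
    (by rwa [Matrix.IsHermitian, Matrix.conjTranspose_eq_transpose_of_trivial]) fun v hv => ?_
  set u : EuclideanSpace ℝ (Fin p) := WithLp.toLp 2 v with hu
  have hu0 : u ≠ 0 := fun h0 => hv (by simpa [hu] using h0)
  have h1 := h (‖u‖⁻¹ • u) (by simp [norm_smul, norm_ne_zero_iff.2 hu0])
  rw [map_smul, real_inner_smul_left, real_inner_smul_right, Matrix.inner_toEuclideanCLM,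
    ← mul_assoc] at h1
  have h2 : 0 < ‖u‖⁻¹ * ‖u‖⁻¹ := by positivity
  have := (mul_pos_iff_of_pos_left h2).1 h1
  simpa using this

/-- Positive definiteness is an open condition on symmetric matrices. -/
lemma eventually_posDef {ι : Type*} {F : Filter ι} {c : ι → Matrix (Fin p) (Fin p) ℝ}
    (hC : C.PosDef) (hc : Tendsto c F (𝓝 C)) (hsymm : ∀ i, (c i)ᵀ = c i) :
    ∀ᶠ i in F, (c i).PosDef := by
  have hopen : ∀ᶠ d in 𝓝 C, ∀ u ∈ Metric.sphere (0 : EuclideanSpace ℝ (Fin p)) 1,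
      0 < ⟪u, matCLM d u⟫ := by
    -- Positivity is open jointly in the matrix and the vector; compactness of the sphere makes the
    -- neighbourhood of `C` uniform.
    refine (isCompact_sphere _ _).eventually_forall_of_forall_eventually fun u hu => ?_
    have hcont : Continuous fun q : Matrix (Fin p) (Fin p) ℝ × EuclideanSpace ℝ (Fin p) =>
        ⟪q.2, matCLM q.1 q.2⟫ := continuous_snd.inner (continuous_fst.matCLM_apply continuous_snd)
    refine hcont.continuousAt.eventually_const_lt (inner_matCLM_self_pos hC ?_)
    rintro rfl
    simp at hu
  filter_upwards [hc.eventually hopen] with i hi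
  exact posDef_of_forall_inner_pos (hsymm i) hi

lemma continuousAt_patternInv (b : EuclideanSpace ℝ (Fin p)) (hC : C.PosDef) :
    ContinuousAt (patternInv b) C := by
  have hG : Continuous fun c : Matrix (Fin p) (Fin p) ℝ =>
      (patternMatrix b)ᵀ * c * patternMatrix b := by fun_prop
  have hinv : ContinuousAt (fun c : Matrix (Fin p) (Fin p) ℝ =>
      ((patternMatrix b)ᵀ * c * patternMatrix b)⁻¹) C := by
    refine ContinuousAt.comp (g := Inv.inv) (continuousAt_matrix_inv _ ?_) hG.continuousAt
    simp only [Ring.inverse_eq_inv']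
    exact continuousAt_inv₀ (isUnit_det_gram b hC).ne_zero
  have hmul : Continuous fun d :
      Matrix (Fin (nonzeroLevels b).card) (Fin (nonzeroLevels b).card) ℝ =>
      patternMatrix b * d * (patternMatrix b)ᵀ := by fun_prop
  exact hmul.continuousAt.comp hinv

/-- The Gram matrix may be singular, where continuity can fail. The formula `det⁻¹ • adjugate`, with
`0⁻¹ = 0`, gives measurability everywhere. -/
lemma measurable_mul_patternInv (b : EuclideanSpace ℝ (Fin p)) :
    Measurable fun (K : Fin p → Fin p → ℝ) (i j : Fin p) =>
      (Matrix.of K * patternInv b (Matrix.of K)) i j := by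
  have hof : Continuous fun K : Fin p → Fin p → ℝ => Matrix.of K := continuous_id
  have hG : Continuous fun K : Fin p → Fin p → ℝ =>
      (patternMatrix b)ᵀ * Matrix.of K * patternMatrix b := by fun_prop
  have hdet : Continuous fun K : Fin p → Fin p → ℝ =>
      ((patternMatrix b)ᵀ * Matrix.of K * patternMatrix b).det := hG.matrix_det
  have hadj : Continuous fun K : Fin p → Fin p → ℝ =>
      ((patternMatrix b)ᵀ * Matrix.of K * patternMatrix b).adjugate := hG.matrix_adjugate
  refine measurable_pi_lambda _ fun i => measurable_pi_lambda _ fun j => ?_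
  have hrest : Continuous fun K : Fin p → Fin p → ℝ => (Matrix.of K * (patternMatrix b *
      ((patternMatrix b)ᵀ * Matrix.of K * patternMatrix b).adjugate * (patternMatrix b)ᵀ)) i j := by
    generalize hg : (fun K : Fin p → Fin p → ℝ =>
      ((patternMatrix b)ᵀ * Matrix.of K * patternMatrix b).adjugate) = g at hadj
    have : Continuous fun K : Fin p → Fin p → ℝ => (Matrix.of K * (patternMatrix b *
      g K * (patternMatrix b)ᵀ)) i j := by fun_prop
    simpa only [← hg] using this
  have heq : (fun K : Fin p → Fin p → ℝ => (Matrix.of K * patternInv b (Matrix.of K)) i j) =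
      fun K => (((patternMatrix b)ᵀ * Matrix.of K * patternMatrix b).det)⁻¹ *
        (Matrix.of K * (patternMatrix b * ((patternMatrix b)ᵀ * Matrix.of K *
          patternMatrix b).adjugate * (patternMatrix b)ᵀ)) i j := by
    funext K
    rw [patternInv, Matrix.inv_def, Ring.inverse_eq_inv', Matrix.mul_smul, Matrix.smul_mul,
      Matrix.mul_smul, Matrix.smul_apply, smul_eq_mul]
  rw [heq]
  exact hdet.measurable.inv.mul hrest.measurable

/-- The slack of the constraints of the dual ball which are not automatic on the affine space of the
residuals: those of the sign vectors outside of the pattern space. -/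
noncomputable def residualSlack (b : EuclideanSpace ℝ (Fin p)) (τ : Equiv.Perm (Fin p))
    (s : Fin p → ℝ) (q : EuclideanSpace ℝ (Fin p) × ((Fin p → Fin p → ℝ) × (Fin p → ℝ)))
    (t : {t : Fin p → SignType // signVec t ∉ patternSpan b}) : ℝ :=
  ⟪q.1 - matCLM (Matrix.of q.2.1) (q.1 - signedPermVec τ s q.2.2), signVec t.1⟫ -
    slopeNorm q.2.2 (signVec t.1)

lemma continuous_residualSlack : Continuous (residualSlack b τ s) := by
  refine continuous_pi fun t => ?_
  have hΛ : Continuous fun l : Fin p → ℝ => signedPermVec τ s l := by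
    unfold signedPermVec
    fun_prop
  have hK : Continuous fun q : EuclideanSpace ℝ (Fin p) × ((Fin p → Fin p → ℝ) × (Fin p → ℝ)) =>
      (Matrix.of q.2.1 : Matrix (Fin p) (Fin p) ℝ) :=
    (continuous_fst.comp continuous_snd : Continuous fun q : EuclideanSpace ℝ (Fin p) ×
      ((Fin p → Fin p → ℝ) × (Fin p → ℝ)) => q.2.1)
  have hv : Continuous fun q : EuclideanSpace ℝ (Fin p) × ((Fin p → Fin p → ℝ) × (Fin p → ℝ)) =>
      q.1 - signedPermVec τ s q.2.2 :=
    continuous_fst.sub (hΛ.comp (continuous_snd.comp continuous_snd))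
  have h1 := Continuous.matCLM_apply hK hv
  have h2 : Continuous fun q : EuclideanSpace ℝ (Fin p) × ((Fin p → Fin p → ℝ) × (Fin p → ℝ)) =>
      slopeNorm q.2.2 (signVec t.1) :=
    (continuous_slopeNorm_left _).comp (continuous_snd.comp continuous_snd)
  have h3 := (continuous_fst.sub h1).inner (𝕜 := ℝ)
    (continuous_const (y := (signVec t.1 : EuclideanSpace ℝ (Fin p))))
  exact h3.sub h2

lemma residualSlack_apply (c : Matrix (Fin p) (Fin p) ℝ) (l : Fin p → ℝ)
    (w : EuclideanSpace ℝ (Fin p)) (t : {t : Fin p → SignType // signVec t ∉ patternSpan b}) :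
    residualSlack b τ s (w, (fun i j => (c * patternInv b c) i j), l) t =
      ⟪slopeResidual b c (signedPermVec τ s l) w, signVec t.1⟫ - slopeNorm l (signVec t.1) := by
  rw [residualSlack, slopeResidual, ← matCLM_mul_apply]
  rfl

/-- For a sign vector in the pattern space the residual pairs like Λ, which already belongs to the
dual ball. Omitting these constraints matters: they may be active identically and would charge the
boundary. -/
lemma residualSlack_nonpos_iff (hs : ∀ i, |s i| ≤ 1) (hl : Antitone l) (hl0 : ∀ i, 0 ≤ l i)
    {c : Matrix (Fin p) (Fin p) ℝ} (hc : c.PosDef) (w : EuclideanSpace ℝ (Fin p)) :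
    (∀ t, residualSlack b τ s (w, (fun i j => (c * patternInv b c) i j), l) t ≤ 0) ↔
      slopeResidual b c (signedPermVec τ s l) w ∈ subdifferential (slopeNorm l) 0 := by
  rw [mem_subdifferential_slopeNorm_zero_iff_signVec]
  simp only [residualSlack_apply, sub_nonpos]
  refine ⟨fun h t => ?_, fun h t => h t.1⟩
  by_cases ht : signVec t ∈ patternSpan b
  · rw [inner_slopeResidual hc _ w ht]
    exact inner_signedPermVec_le hl hl0 hs τ _
  · exact h ⟨t, ht⟩

/-- Dominated convergence for the difference of the indicators. This transfers the limit to the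
pattern recovery events. -/
lemma tendsto_real_of_ae_eventually_iff {Ω : Type*} {mΩ : MeasurableSpace Ω} {μ : Measure Ω}
    [IsProbabilityMeasure μ] {A B : ℕ → Set Ω} (hA : ∀ n, NullMeasurableSet (A n) μ)
    (hB : ∀ n, NullMeasurableSet (B n) μ) (h : ∀ᵐ ω ∂μ, ∀ᶠ n in atTop, ω ∈ A n ↔ ω ∈ B n) {r : ℝ}
    (hr : Tendsto (fun n => μ.real (B n)) atTop (𝓝 r)) :
    Tendsto (fun n => μ.real (A n)) atTop (𝓝 r) := by
  have hind : ∀ {S : Set Ω}, NullMeasurableSet S μ →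
      Integrable (S.indicator fun _ => (1 : ℝ)) μ ∧ ∫ ω, S.indicator (fun _ => (1 : ℝ)) ω ∂μ =
        μ.real S := fun {S} hS => by
    refine ⟨(integrable_const (1 : ℝ)).indicator₀ hS, ?_⟩
    rw [integral_indicator₀ hS]
    simp
  have hlim : Tendsto (fun n => ∫ ω, ((A n).indicator (fun _ => (1 : ℝ)) ω -
      (B n).indicator (fun _ => (1 : ℝ)) ω) ∂μ) atTop (𝓝 (∫ _, (0 : ℝ) ∂μ)) := by
    refine tendsto_integral_of_dominated_convergence (fun _ => 1)
      (fun n => ((hind (hA n)).1.sub (hind (hB n)).1).1) (integrable_const _) (fun n => ?_) ?_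
    · refine Eventually.of_forall fun ω => ?_
      by_cases h1 : ω ∈ A n <;> by_cases h2 : ω ∈ B n <;> simp [h1, h2]
    · filter_upwards [h] with ω hω
      refine tendsto_const_nhds.congr' ?_
      filter_upwards [hω] with n hn
      by_cases h1 : ω ∈ A n
      · simp [h1, hn.1 h1]
      · simp [h1, mt hn.2 h1]
  have := hlim.add hr
  simp only [integral_zero, zero_add] at this
  refine this.congr fun n => ?_
  rw [integral_sub (hind (hA n)).1 (hind (hB n)).1, (hind (hA n)).2, (hind (hB n)).2]
  ring

end Limits

/-! ### The pattern projection and the limiting Gaussian residual -/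

section Projection

variable {p : ℕ} {b : EuclideanSpace ℝ (Fin p)} {C : Matrix (Fin p) (Fin p) ℝ}

lemma matrixSqrt_mul_self (hC : C.PosDef) : matrixSqrt C * matrixSqrt C = C :=
  CFC.sqrt_mul_sqrt_self C hC.posSemidef.nonneg

lemma transpose_matrixSqrt (C : Matrix (Fin p) (Fin p) ℝ) : (matrixSqrt C)ᵀ = matrixSqrt C := by
  have h : IsSelfAdjoint (CFC.sqrt C) := (CFC.sqrt_nonneg C).isSelfAdjoint
  have h' : (CFC.sqrt C)ᴴ = CFC.sqrt C := h
  rwa [Matrix.conjTranspose_eq_transpose_of_trivial] at h'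

lemma isUnit_det_matrixSqrt (hC : C.PosDef) : IsUnit (matrixSqrt C).det := by
  have h := hC.det_pos.ne'
  rw [← matrixSqrt_mul_self hC, Matrix.det_mul] at h
  exact (left_ne_zero_of_mul h).isUnit

lemma patternProjection_eq (C : Matrix (Fin p) (Fin p) ℝ) (b : EuclideanSpace ℝ (Fin p)) :
    patternProjection C b = matrixSqrt C * patternInv b C * matrixSqrt C := by
  simp only [patternProjection, patternInv, Matrix.mul_assoc]

lemma transpose_patternInv (hC : Cᵀ = C) : (patternInv b C)ᵀ = patternInv b C := by
  simp only [patternInv, Matrix.transpose_mul, Matrix.transpose_transpose,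
    Matrix.transpose_nonsing_inv, hC, Matrix.mul_assoc]

lemma patternInv_mul_mul_patternInv (hC : C.PosDef) :
    patternInv b C * C * patternInv b C = patternInv b C := by
  conv_lhs => rw [Matrix.mul_assoc]
  conv_lhs => enter [1]; rw [patternInv]
  rw [Matrix.mul_assoc _ (patternMatrix b)ᵀ, transpose_mul_mul_patternInv hC]
  rfl

/-- Orthogonality is the normal equation with `Λ = 0` and `w = C^{1/2} x`, after moving one factor
`C^{1/2}` across the inner product. -/
theorem toEuclideanCLM_patternProjection (hC : C.PosDef) :
    Matrix.toEuclideanCLM (𝕜 := ℝ) (patternProjection C b) =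
      ((patternSpan b).map (Matrix.toEuclideanLin (matrixSqrt C))).starProjection := by
  ext1 x
  symm
  have hP : Matrix.toEuclideanCLM (𝕜 := ℝ) (patternProjection C b) x =
      matCLM (matrixSqrt C) (matCLM (patternInv b C) (matCLM (matrixSqrt C) x)) := by
    rw [patternProjection_eq, ← matCLM_mul_apply, ← matCLM_mul_apply]
  rw [hP]
  refine Submodule.eq_starProjection_of_mem_of_inner_eq_zero
    (Submodule.mem_map_of_mem (matCLM_patternInv_mem b C _)) fun v hv => ?_
  obtain ⟨u, hu, rfl⟩ := Submodule.mem_map.1 hv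
  have h := inner_slopeResidual hC 0 (matCLM (matrixSqrt C) x) hu
  rw [inner_zero_left, slopeResidual, sub_zero] at h
  change ⟪_, matCLM (matrixSqrt C) u⟫ = 0
  rw [inner_matCLM, transpose_matrixSqrt, map_sub, ← matCLM_mul_apply (matrixSqrt C) (matrixSqrt C),
    matrixSqrt_mul_self hC, h]

end Projection

section GaussianResidual

variable {p : ℕ} {b : EuclideanSpace ℝ (Fin p)} {C : Matrix (Fin p) (Fin p) ℝ} {σ : ℝ}
  {Ω : Type*} {mΩ : MeasurableSpace Ω} {μ : Measure Ω} {W : Ω → EuclideanSpace ℝ (Fin p)}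

lemma matCLM_one_sub (c : Matrix (Fin p) (Fin p) ℝ) (u : EuclideanSpace ℝ (Fin p)) :
    matCLM (1 - c) u = u - matCLM c u := by
  simp [matCLM_apply]

/-- With `H = patternInv b C`, the residual is the affine map `(1 - C H) w + C H Λ`. -/
lemma inner_slopeResidual_eq (b : EuclideanSpace ℝ (Fin p)) (C : Matrix (Fin p) (Fin p) ℝ)
    (Λ w t : EuclideanSpace ℝ (Fin p)) :
    ⟪t, slopeResidual b C Λ w⟫ = ⟪matCLM (1 - C * patternInv b C)ᵀ t, w⟫ +
      ⟪t, matCLM (C * patternInv b C) Λ⟫ := by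
  rw [← inner_matCLM, ← inner_add_right, slopeResidual, ← matCLM_mul_apply, map_sub,
    matCLM_one_sub]
  congr 1
  abel

/-- The transpose is `1 - H C`, so its kernel lies in the range of `H`, inside the pattern space.
Outside it, the projected residual has positive variance. -/
lemma matCLM_one_sub_transpose_ne_zero (hC : C.PosDef) {t : EuclideanSpace ℝ (Fin p)}
    (ht : t ∉ patternSpan b) : matCLM (1 - C * patternInv b C)ᵀ t ≠ 0 := by
  intro h
  apply ht
  have hs := transpose_eq_of_posDef hC
  have h1 : (1 - C * patternInv b C)ᵀ = 1 - patternInv b C * C := by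
    rw [Matrix.transpose_sub, Matrix.transpose_one, Matrix.transpose_mul, hs,
      transpose_patternInv hs]
  rw [h1, matCLM_one_sub, matCLM_mul_apply, sub_eq_zero] at h
  rw [h]
  exact matCLM_patternInv_mem b C _

lemma posSemidef_smul_sq (hC : C.PosDef) (σ : ℝ) : (σ ^ 2 • C).PosSemidef :=
  hC.posSemidef.smul (sq_nonneg σ)

/-- A constraint of the dual ball which is not automatic is almost surely not active. -/
lemma measure_inner_slopeResidual_eq_zero (hC : C.PosDef) (hσ : 0 < σ)
    (hW : HasLaw W (multivariateGaussian 0 (σ ^ 2 • C)) μ) (Λ : EuclideanSpace ℝ (Fin p))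
    {t : EuclideanSpace ℝ (Fin p)} (ht : t ∉ patternSpan b) (a : ℝ) :
    μ {ω | ⟪slopeResidual b C Λ (W ω), t⟫ = a} = 0 := by
  set q := matCLM (1 - C * patternInv b C)ᵀ t with hq
  have hq0 : q ≠ 0 := matCLM_one_sub_transpose_ne_zero hC ht
  have hlaw := hasLaw_inner_of_multivariateGaussian (posSemidef_smul_sq hC σ) hW q
  have hpos : 0 < q.ofLp ⬝ᵥ (σ ^ 2 • C) *ᵥ q.ofLp := by
    rw [Matrix.smul_mulVec, dotProduct_smul, ← Matrix.inner_toEuclideanCLM]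
    exact mul_pos (by positivity) (inner_matCLM_self_pos hC hq0)
  have := nullSingletonClass_gaussianReal (μ := ⟪q, 0⟫) (Real.toNNReal_pos.2 hpos).ne'
  have hset : {ω | ⟪slopeResidual b C Λ (W ω), t⟫ = a} =
      (fun ω => ⟪q, W ω⟫) ⁻¹' {a - ⟪t, matCLM (C * patternInv b C) Λ⟫} := by
    ext ω
    rw [Set.mem_ofPred_eq, real_inner_comm, inner_slopeResidual_eq, ← hq, Set.mem_preimage,
      Set.mem_singleton_iff, eq_sub_iff_add_eq]
  rw [hset, ← Measure.map_apply_of_aemeasurable hlaw.aemeasurable (measurableSet_singleton _),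
    hlaw.map_eq]
  exact measure_singleton _

/-- Both sides equal `σ² (C - C H C)`, by `H C H = H`. -/
lemma residual_covariance (hC : C.PosDef) (σ : ℝ) :
    σ ^ 2 • (matrixSqrt C * (1 - patternProjection C b) * matrixSqrt C) =
      (1 - C * patternInv b C) * (σ ^ 2 • C) * (1 - C * patternInv b C)ᵀ := by
  have hs := transpose_eq_of_posDef hC
  have hR := matrixSqrt_mul_self hC
  have hH := patternInv_mul_mul_patternInv (b := b) hC
  have h1 : matrixSqrt C * (1 - patternProjection C b) * matrixSqrt C =
      C - C * patternInv b C * C := by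
    rw [patternProjection_eq, Matrix.mul_sub, Matrix.sub_mul, Matrix.mul_one, hR]
    congr 1
    calc matrixSqrt C * (matrixSqrt C * patternInv b C * matrixSqrt C) * matrixSqrt C
        = (matrixSqrt C * matrixSqrt C) * patternInv b C * (matrixSqrt C * matrixSqrt C) := by
          simp only [Matrix.mul_assoc]
      _ = C * patternInv b C * C := by rw [hR]
  have h2 : (1 - C * patternInv b C) * C * (1 - C * patternInv b C)ᵀ =
      C - C * patternInv b C * C := by
    rw [Matrix.transpose_sub, Matrix.transpose_one, Matrix.transpose_mul, hs,
      transpose_patternInv hs]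
    have h3 : C * patternInv b C * C * (patternInv b C * C) = C * patternInv b C * C := by
      calc C * patternInv b C * C * (patternInv b C * C)
          = C * (patternInv b C * C * patternInv b C) * C := by simp only [Matrix.mul_assoc]
        _ = C * patternInv b C * C := by rw [hH]
    rw [Matrix.sub_mul, Matrix.one_mul, Matrix.mul_sub, Matrix.mul_one, Matrix.sub_mul,
      h3, ← Matrix.mul_assoc]
    abel
  rw [h1, Matrix.mul_smul, Matrix.smul_mul, h2]

lemma residual_mean (hC : C.PosDef) :
    matrixSqrt C * patternProjection C b * (matrixSqrt C)⁻¹ = C * patternInv b C := by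
  rw [patternProjection_eq]
  calc matrixSqrt C * (matrixSqrt C * patternInv b C * matrixSqrt C) * (matrixSqrt C)⁻¹
      = (matrixSqrt C * matrixSqrt C) * patternInv b C * (matrixSqrt C * (matrixSqrt C)⁻¹) := by
        simp only [Matrix.mul_assoc]
    _ = C * patternInv b C := by
        rw [matrixSqrt_mul_self hC, Matrix.mul_nonsing_inv _ (isUnit_det_matrixSqrt hC),
          Matrix.mul_one]

lemma continuous_slopeResidual (b : EuclideanSpace ℝ (Fin p)) (C : Matrix (Fin p) (Fin p) ℝ)
    (Λ : EuclideanSpace ℝ (Fin p)) : Continuous (slopeResidual b C Λ) := by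
  unfold slopeResidual
  fun_prop

/-- The law of the residual of the limiting problem. -/
lemma hasLaw_slopeResidual [IsProbabilityMeasure μ] (hC : C.PosDef)
    (hW : HasLaw W (multivariateGaussian 0 (σ ^ 2 • C)) μ) (Λ : Fin p → ℝ) :
    HasLaw (fun ω => slopeResidual b C (WithLp.toLp 2 Λ) (W ω)) (multivariateGaussian
      (WithLp.toLp 2 ((matrixSqrt C * patternProjection C b * (matrixSqrt C)⁻¹) *ᵥ Λ))
      (σ ^ 2 • (matrixSqrt C * (1 - patternProjection C b) * matrixSqrt C))) μ := by
  have hm : AEMeasurable (fun ω => slopeResidual b C (WithLp.toLp 2 Λ) (W ω)) μ :=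
    (continuous_slopeResidual b C _).measurable.comp_aemeasurable hW.aemeasurable
  refine ⟨hm, ?_⟩
  have hprob := Measure.isProbabilityMeasure_map hm
  refine Measure.ext_of_charFun (funext fun t => ?_)
  have hpsd : (σ ^ 2 • (matrixSqrt C * (1 - patternProjection C b) * matrixSqrt C)).PosSemidef := by
    rw [residual_covariance hC]
    have := (posSemidef_smul_sq hC σ).mul_mul_conjTranspose_same (1 - C * patternInv b C)
    rwa [Matrix.conjTranspose_eq_transpose_of_trivial] at this
  rw [charFun_multivariateGaussian hpsd, residual_mean hC, residual_covariance hC,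
    charFun_map_inner hm]
  set q := matCLM (1 - C * patternInv b C)ᵀ t with hq
  set a := ⟪t, matCLM (C * patternInv b C) (WithLp.toLp 2 Λ)⟫ with ha
  have hsplit : (fun ω => ⟪t, slopeResidual b C (WithLp.toLp 2 Λ) (W ω)⟫) =
      fun ω => ⟪q, W ω⟫ + a := by
    funext ω
    rw [inner_slopeResidual_eq]
  have hW1 := charFun_map_inner hW.aemeasurable q
  rw [hW.map_eq, charFun_multivariateGaussian (posSemidef_smul_sq hC σ)] at hW1
  have hqW : AEMeasurable (fun ω => ⟪q, W ω⟫) μ :=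
    (by fun_prop : Measurable fun x : EuclideanSpace ℝ (Fin p) => ⟪q, x⟫).comp_aemeasurable
      hW.aemeasurable
  have hcomp : μ.map (fun ω => ⟪q, W ω⟫ + a) = (μ.map fun ω => ⟪q, W ω⟫).map (· + a) := by
    rw [AEMeasurable.map_map_of_aemeasurable (by fun_prop) hqW]
    rfl
  rw [hsplit, hcomp, charFun_map_add_const, ← hW1, ← Complex.exp_add]
  congr 1
  have hquad : q.ofLp ⬝ᵥ (σ ^ 2 • C) *ᵥ q.ofLp =
      t.ofLp ⬝ᵥ ((1 - C * patternInv b C) * (σ ^ 2 • C) * (1 - C * patternInv b C)ᵀ) *ᵥ t.ofLp := by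
    rw [← Matrix.inner_toEuclideanCLM, ← Matrix.inner_toEuclideanCLM, matCLM_mul_apply,
      matCLM_mul_apply, inner_matCLM (1 - C * patternInv b C)]
  rw [hquad, ha, matCLM_apply]
  simp
  ring

end GaussianResidual

/-! ### Almost sure limits -/

section AlmostSure

variable {p : ℕ} {Ω : Type*} {mΩ : MeasurableSpace Ω} {μ : Measure Ω}
  {X : ℕ → Ω → EuclideanSpace ℝ (Fin p)} {ε : ℕ → Ω → ℝ} {C : Matrix (Fin p) (Fin p) ℝ}
  {b : EuclideanSpace ℝ (Fin p)}

/-- Strong law entry by entry; centering turns second moments into covariances. -/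
lemma ae_tendsto_empiricalGram [IsProbabilityMeasure μ] (hX_indep : iIndepFun X μ)
    (hX_ident : ∀ i, IdentDistrib (X i) (X 0) μ μ) (hX_L2 : MemLp (X 0) 2 μ)
    (hX_mean : ∫ ω, X 0 ω ∂μ = 0)
    (hX_cov : ∀ a b, covariance (fun ω => X 0 ω a) (fun ω => X 0 ω b) μ = C a b) :
    ∀ᵐ ω ∂μ, Tendsto (fun n => empiricalGram n fun i => X i ω) atTop (𝓝 C) := by
  have hcoord : ∀ a, MemLp (fun ω => X 0 ω a) 2 μ := fun a =>
    (EuclideanSpace.proj (𝕜 := ℝ) a).comp_memLp' hX_L2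
  have hmean : ∀ a, ∫ ω, X 0 ω a ∂μ = 0 := fun a => by
    have := (EuclideanSpace.proj (𝕜 := ℝ) a).integral_comp_comm (hX_L2.integrable (by norm_num))
    rw [hX_mean, map_zero] at this
    exact this
  have hmeas : ∀ a c, Measurable fun x : EuclideanSpace ℝ (Fin p) => x a * x c := fun a c => by
    fun_prop
  have hlln : ∀ a c, ∀ᵐ ω ∂μ,
      Tendsto (fun n => empiricalGram n (fun i => X i ω) a c) atTop (𝓝 (C a c)) := fun a c => by
    have h1 := strong_law_ae_real (μ := μ) (fun i ω => X i ω a * X i ω c)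
      ((hcoord a).integrable_mul (hcoord c))
      (fun i j hij => (hX_indep.indepFun hij).comp (hmeas a c) (hmeas a c))
      (fun i => (hX_ident i).comp (hmeas a c))
    have h2 : ∫ ω, X 0 ω a * X 0 ω c ∂μ = C a c := by
      have h3 := covariance_eq_sub (hcoord a) (hcoord c)
      rw [hmean, zero_mul, sub_zero, hX_cov] at h3
      exact h3.symm
    rw [h2] at h1
    simpa only [empiricalGram_apply] using h1
  filter_upwards [ae_all_iff.2 fun a => ae_all_iff.2 (hlln a)] with ω hω
  exact tendsto_pi_nhds.2 fun a => tendsto_pi_nhds.2 fun c => hω a c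

lemma indepFun_pair (hXε : IndepFun (fun ω i => X i ω) (fun ω i => ε i ω) μ) (i : ℕ) :
    IndepFun (X i) (ε i) μ :=
  hXε.comp (measurable_pi_apply i) (measurable_pi_apply i)

lemma iIndepFun_smul (hX_indep : iIndepFun X μ) (hX : ∀ i, AEMeasurable (X i) μ)
    (hε_indep : iIndepFun ε μ) (hε : ∀ i, AEMeasurable (ε i) μ)
    (hXε : IndepFun (fun ω i => X i ω) (fun ω i => ε i ω) μ) :
    iIndepFun (fun i ω => ε i ω • X i ω) μ :=
  (iIndepFun_prodMk_of_indepFun hX hε hX_indep hε_indep hXε).comp (fun _ q => q.2 • q.1)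
    fun _ => by fun_prop

lemma identDistrib_smul [IsProbabilityMeasure μ] (hX_ident : ∀ i, IdentDistrib (X i) (X 0) μ μ)
    (hε_ident : ∀ i, IdentDistrib (ε i) (ε 0) μ μ)
    (hXε : IndepFun (fun ω i => X i ω) (fun ω i => ε i ω) μ) (i : ℕ) :
    IdentDistrib (fun ω => ε i ω • X i ω) (fun ω => ε 0 ω • X 0 ω) μ μ :=
  ((hX_ident i).prodMk (hε_ident i) (indepFun_pair hXε i) (indepFun_pair hXε 0)).comp
    (u := fun q : EuclideanSpace ℝ (Fin p) × ℝ => q.2 • q.1) (by fun_prop)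

/-- The rescaled score is the average of the centered vectors `ε i • X i`. The score itself is only
controlled in law, and this rate suffices for the pattern of the candidate. -/
lemma ae_tendsto_smul_empiricalScore [IsProbabilityMeasure μ] (hX_indep : iIndepFun X μ)
    (hX_ident : ∀ i, IdentDistrib (X i) (X 0) μ μ) (hX_L2 : MemLp (X 0) 2 μ)
    (hε_indep : iIndepFun ε μ) (hε_ident : ∀ i, IdentDistrib (ε i) (ε 0) μ μ)
    (hε_L2 : MemLp (ε 0) 2 μ) (hε_mean : ∫ ω, ε 0 ω ∂μ = 0)
    (hXε : IndepFun (fun ω i => X i ω) (fun ω i => ε i ω) μ) :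
    ∀ᵐ ω ∂μ, Tendsto (fun n : ℕ => (√(n : ℝ))⁻¹ •
      empiricalScore n (fun i => X i ω) fun i => ε i ω) atTop (𝓝 0) := by
  have hind := iIndepFun_smul hX_indep (fun i => (hX_ident i).aemeasurable_fst) hε_indep
    (fun i => (hε_ident i).aemeasurable_fst) hXε
  have h0 := integral_smul_eq_zero_of_indepFun hX_L2 hε_L2 (indepFun_pair hXε 0) hε_mean
  have h1 := strong_law_ae (μ := μ) (fun i ω => ε i ω • X i ω)
    ((memLp_smul_of_indepFun hX_L2 hε_L2 (indepFun_pair hXε 0)).integrable (by norm_num))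
    (fun i j hij => hind.indepFun hij) (identDistrib_smul hX_ident hε_ident hXε)
  rw [h0] at h1
  filter_upwards [h1] with ω hω
  refine hω.congr fun n => ?_
  rw [empiricalScore, smul_smul, ← mul_inv, Real.mul_self_sqrt (by positivity)]

/-- The minimizer over the pattern space has the right pattern in large samples. -/
lemma eventually_samePattern_add_smul_patternInv {c : ℕ → Matrix (Fin p) (Fin p) ℝ}
    {w : ℕ → EuclideanSpace ℝ (Fin p)} {l₁ : ℕ → Fin p → ℝ} {l s : Fin p → ℝ}
    (τ : Equiv.Perm (Fin p)) (hC : C.PosDef) (hc : Tendsto c atTop (𝓝 C))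
    (hw : Tendsto (fun n : ℕ => (√(n : ℝ))⁻¹ • w n) atTop (𝓝 0))
    (hl : Tendsto l₁ atTop (𝓝 l)) :
    ∀ᶠ n : ℕ in atTop, SamePattern b (b + (√(n : ℝ))⁻¹ •
      matCLM (patternInv b (c n)) (w n - signedPermVec τ s (l₁ n))) := by
  have hsqrt : Tendsto (fun n : ℕ => (√(n : ℝ))⁻¹) atTop (𝓝 0) :=
    tendsto_inv_atTop_zero.comp (Real.tendsto_sqrt_atTop.comp tendsto_natCast_atTop_atTop)
  have hΛc : Continuous fun l : Fin p → ℝ => signedPermVec τ s l := by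
    unfold signedPermVec
    fun_prop
  have hΛ : Tendsto (fun n : ℕ => (√(n : ℝ))⁻¹ • signedPermVec τ s (l₁ n)) atTop (𝓝 0) := by
    simpa using hsqrt.smul ((hΛc.tendsto l).comp hl)
  have hH := (continuousAt_patternInv b hC).tendsto.comp hc
  have hact : Continuous fun q : Matrix (Fin p) (Fin p) ℝ × EuclideanSpace ℝ (Fin p) =>
      b + matCLM q.1 q.2 :=
    continuous_const.add (continuous_fst.matCLM_apply continuous_snd)
  have hlim : Tendsto (fun n : ℕ => b + (√(n : ℝ))⁻¹ •
      matCLM (patternInv b (c n)) (w n - signedPermVec τ s (l₁ n))) atTop (𝓝 b) := by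
    have h1 := (hact.tendsto (patternInv b C, 0 - 0)).comp (hH.prodMk_nhds (hw.sub hΛ))
    simp only [sub_zero, map_zero, add_zero] at h1
    refine h1.congr fun n => ?_
    simp only [Function.comp_apply, ← smul_sub, map_smul]
  filter_upwards [hlim.eventually (eventually_samePattern b)] with n hn
  exact hn (Submodule.add_mem _ (SamePattern.refl b).mem_patternSpan
    (Submodule.smul_mem _ _ (matCLM_patternInv_mem b _ _)))

end AlmostSure

/-! ### Convergence in law of the constraint slacks -/

section Convergence

variable {p : ℕ} {Ω Ω₁ : Type*} {mΩ : MeasurableSpace Ω} {mΩ₁ : MeasurableSpace Ω₁}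
  {μ : Measure Ω} [IsProbabilityMeasure μ] {μ₁ : Measure Ω₁} [IsProbabilityMeasure μ₁]
  {C : Matrix (Fin p) (Fin p) ℝ} {b : EuclideanSpace ℝ (Fin p)} {σ : ℝ}
  {τ : Equiv.Perm (Fin p)} {s l : Fin p → ℝ}

lemma frontier_forall_nonpos_subset {T : Type*} :
    frontier {d : T → ℝ | ∀ t, d t ≤ 0} ⊆ {d | ∀ t, d t ≤ 0} := by
  have : IsClosed {d : T → ℝ | ∀ t, d t ≤ 0} := by
    simp only [Set.ofPred_forall]
    exact isClosed_iInter fun t => isClosed_le (continuous_apply t) continuous_const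
  exact this.frontier_subset

/-- With finitely many coordinates, strict inequalities define an open set, so a point with all
constraints strict is interior. -/
lemma exists_eq_zero_of_mem_frontier {T : Type*} [Finite T] {d : T → ℝ}
    (hd : d ∈ frontier {d : T → ℝ | ∀ t, d t ≤ 0}) : ∃ t, d t = 0 := by
  by_contra! h
  have hle := frontier_forall_nonpos_subset hd
  have hopen : IsOpen {d : T → ℝ | ∀ t, d t < 0} := by
    simp only [Set.ofPred_forall]
    exact isOpen_iInter_of_finite fun t => isOpen_lt (continuous_apply t) continuous_const
  have hsub : {d : T → ℝ | ∀ t, d t < 0} ⊆ {d | ∀ t, d t ≤ 0} := fun d hd t => (hd t).le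
  exact hd.2 (interior_maximal hsub hopen fun t => lt_of_le_of_ne (hle t) (h t))

/-- The probabilities that all the constraints hold converge. -/
lemma tendsto_measure_residualSlack_nonpos (hC : C.PosDef) (hσ : 0 < σ)
    {w : ℕ → Ω → EuclideanSpace ℝ (Fin p)} {c : ℕ → Ω → Matrix (Fin p) (Fin p) ℝ}
    {l₁ : ℕ → Fin p → ℝ} {W : Ω₁ → EuclideanSpace ℝ (Fin p)}
    (hW : HasLaw W (multivariateGaussian 0 (σ ^ 2 • C)) μ₁)
    (hw : TendstoInDistribution w atTop W (fun _ => μ) μ₁)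
    (hcm : ∀ n i j, AEMeasurable (fun ω => c n ω i j) μ)
    (hc : ∀ᵐ ω ∂μ, Tendsto (fun n => c n ω) atTop (𝓝 C)) (hl : Tendsto l₁ atTop (𝓝 l)) :
    (∀ n, NullMeasurableSet {ω | ∀ t, residualSlack b τ s (w n ω,
      (fun i j => (c n ω * patternInv b (c n ω)) i j), l₁ n) t ≤ 0} μ) ∧
    Tendsto (fun n => μ.real {ω | ∀ t, residualSlack b τ s (w n ω,
      (fun i j => (c n ω * patternInv b (c n ω)) i j), l₁ n) t ≤ 0}) atTop
      (𝓝 (μ₁.real {ω | ∀ t, residualSlack b τ s (W ω,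
        (fun i j => (C * patternInv b C) i j), l) t ≤ 0})) := by
  set O : Set ({t : Fin p → SignType // signVec t ∉ patternSpan b} → ℝ) :=
    {d | ∀ t, d t ≤ 0} with hO
  have hOm : MeasurableSet O := by
    simp only [hO, Set.ofPred_forall]
    exact MeasurableSet.iInter fun t => measurableSet_le (measurable_pi_apply t) measurable_const
  let Y : ℕ → Ω → (Fin p → Fin p → ℝ) × (Fin p → ℝ) := fun n ω =>
    ((fun i j => (c n ω * patternInv b (c n ω)) i j), l₁ n)
  have hYm : ∀ n, AEMeasurable (Y n) μ := fun n => by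
    have h1 : AEMeasurable (fun ω i j => c n ω i j) μ :=
      aemeasurable_pi_lambda _ fun i => aemeasurable_pi_lambda _ fun j => hcm n i j
    exact ((measurable_mul_patternInv b).comp_aemeasurable h1).prodMk aemeasurable_const
  have hYlim : ∀ᵐ ω ∂μ, Tendsto (fun n => Y n ω) atTop
      (𝓝 ((fun i j => (C * patternInv b C) i j), l)) := by
    filter_upwards [hc] with ω hω
    have h1 : Tendsto (fun n => c n ω * patternInv b (c n ω)) atTop (𝓝 (C * patternInv b C)) :=
      hω.mul ((continuousAt_patternInv b hC).tendsto.comp hω)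
    exact Tendsto.prodMk_nhds h1 hl
  -- Slutsky: the matrix and the weights have a constant limit, so joint convergence with the score
  -- is free.
  have hYmeas := tendstoInMeasure_of_tendsto_ae (fun n => (hYm n).aestronglyMeasurable) hYlim
  have hD := hw.continuous_comp_prodMk_of_tendstoInMeasure_const
    (continuous_residualSlack (b := b) (τ := τ) (s := s)) hYmeas hYm
  have hnull : μ₁.map (fun ω => residualSlack b τ s (W ω,
      (fun i j => (C * patternInv b C) i j), l)) (frontier O) = 0 := by
    rw [Measure.map_apply_of_aemeasurable hD.aemeasurable_limit isClosed_frontier.measurableSet]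
    refine measure_mono_null (t := ⋃ t : {t : Fin p → SignType // signVec t ∉ patternSpan b},
      {ω | ⟪slopeResidual b C (signedPermVec τ s l) (W ω), signVec t.1⟫ =
        slopeNorm l (signVec t.1)}) (fun ω hω => ?_) (measure_iUnion_null fun t =>
        measure_inner_slopeResidual_eq_zero hC hσ hW _ t.2 _)
    obtain ⟨t, ht⟩ := exists_eq_zero_of_mem_frontier hω
    exact Set.mem_iUnion.2 ⟨t, sub_eq_zero.1 ((residualSlack_apply C l (W ω) t).symm.trans ht)⟩
  have hlim := ProbabilityMeasure.tendsto_measure_of_null_frontier_of_tendsto' hD.tendsto hnull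
  refine ⟨fun n => (hD.forall_aemeasurable n).nullMeasurableSet_preimage hOm, ?_⟩
  have := Measure.isProbabilityMeasure_map hD.aemeasurable_limit
  have hreal := (ENNReal.tendsto_toReal (measure_ne_top (μ₁.map (fun ω => residualSlack b τ s (W ω,
      (fun i j => (C * patternInv b C) i j), l))) O)).comp hlim
  have hR : ∀ n, (μ.map (fun ω => residualSlack b τ s (w n ω, Y n ω)) O).toReal =
      μ.real {ω | ∀ t, residualSlack b τ s (w n ω, Y n ω) t ≤ 0} := fun n => by
    rw [Measure.map_apply_of_aemeasurable (hD.forall_aemeasurable n) hOm]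
    rfl
  have hR' : (μ₁.map (fun ω => residualSlack b τ s (W ω,
      (fun i j => (C * patternInv b C) i j), l)) O).toReal =
      μ₁.real {ω | ∀ t, residualSlack b τ s (W ω,
        (fun i j => (C * patternInv b C) i j), l) t ≤ 0} := by
    rw [Measure.map_apply_of_aemeasurable hD.aemeasurable_limit hOm]
    rfl
  rw [← hR']
  exact hreal.congr hR

end Convergence

theorem mainTheorem6 {p : ℕ}
    {Ω Ω₁ Ω₂ : Type*} [MeasurableSpace Ω] [MeasurableSpace Ω₁] [MeasurableSpace Ω₂]
    (μ : Measure Ω) [IsProbabilityMeasure μ]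
    (μ₁ : Measure Ω₁) [IsProbabilityMeasure μ₁] (μ₂ : Measure Ω₂) [IsProbabilityMeasure μ₂]
    (X : ℕ → Ω → EuclideanSpace ℝ (Fin p)) (ε y : ℕ → Ω → ℝ)
    (β₀ : EuclideanSpace ℝ (Fin p)) (C : Matrix (Fin p) (Fin p) ℝ) (σ : ℝ)
    -- the rows are i.i.d., centered, with positive definite covariance matrix `C`
    (hX_indep : iIndepFun X μ) (hX_ident : ∀ i, IdentDistrib (X i) (X 0) μ μ)
    (hX_L2 : MemLp (X 0) 2 μ) (hX_mean : ∫ ω, X 0 ω ∂μ = 0)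
    (hX_cov : ∀ a b, covariance (fun ω => X 0 ω a) (fun ω => X 0 ω b) μ = C a b)
    (hC : C.PosDef)
    -- the noise is i.i.d., centered, with variance `σ² > 0`, and independent of the rows
    (hε_indep : iIndepFun ε μ) (hε_ident : ∀ i, IdentDistrib (ε i) (ε 0) μ μ)
    (hε_L2 : MemLp (ε 0) 2 μ) (hε_mean : ∫ ω, ε 0 ω ∂μ = 0)
    (hε_var : variance (ε 0) μ = σ ^ 2) (hσ : 0 < σ)
    (hXε : IndepFun (fun ω i => X i ω) (fun ω i => ε i ω) μ)
    -- the linear model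
    (hy : ∀ i ω, y i ω = ⟪X i ω, β₀⟫ + ε i ω)
    -- the penalty vectors
    (lam : ℕ → Fin p → ℝ) (l : Fin p → ℝ)
    (hlam_anti : ∀ n, Antitone (lam n)) (hlam_nonneg : ∀ n i, 0 ≤ lam n i)
    (hlam_lim : Tendsto (fun n : ℕ => (√(n : ℝ))⁻¹ • lam n) atTop (𝓝 l))
    -- the SLOPE estimators
    (βhat : ℕ → Ω → EuclideanSpace ℝ (Fin p)) (hβ_meas : ∀ n, AEMeasurable (βhat n) μ)
    (hβ : ∀ n, ∀ᵐ ω ∂μ, IsMinOn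
      (slopeObjective n (fun i => X i ω) (fun i => y i ω) (lam n)) Set.univ (βhat n ω))
    -- the minimizer of the limiting objective
    (W uhat : Ω₁ → EuclideanSpace ℝ (Fin p))
    (hW : HasLaw W (multivariateGaussian 0 (σ ^ 2 • C)) μ₁)
    (hu : ∀ᵐ ω ∂μ₁, IsMinOn (limitObjective C l β₀ (W ω)) Set.univ (uhat ω))
    -- the vector `Λ₀` and the Gaussian vector `Z`
    (Q : Matrix (Fin p) (Fin p) ℝ) (hQ : IsSortingMatrix Q β₀)
    (Λ₀ : Fin p → ℝ) (hΛ₀ : Λ₀ = (signMatrix β₀ * Q) *ᵥ l)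
    (P : Matrix (Fin p) (Fin p) ℝ) (hP : P = patternProjection C β₀)
    (Z : Ω₂ → EuclideanSpace ℝ (Fin p))
    (hZ : HasLaw Z (multivariateGaussian
      (WithLp.toLp 2 ((matrixSqrt C * P * (matrixSqrt C)⁻¹) *ᵥ Λ₀))
      (σ ^ 2 • (matrixSqrt C * (1 - P) * matrixSqrt C))) μ₂) :
    Tendsto (fun n => μ.real {ω | slopePattern (βhat n ω) = slopePattern β₀}) atTop
      (𝓝 (μ₁.real {ω | uhat ω ∈ patternSpan β₀})) ∧
    μ₁.real {ω | uhat ω ∈ patternSpan β₀} =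
      μ₂.real {ω | Z ω ∈ subdifferential (slopeNorm l) 0} ∧
    Matrix.toEuclideanCLM (𝕜 := ℝ) P =
      ((patternSpan β₀).map (Matrix.toEuclideanLin (matrixSqrt C))).starProjection := by
  obtain ⟨τ, s, hb, hs, hΛ⟩ := hQ.exists_aligned
  have hl₁ : ∀ n : ℕ, Antitone ((√(n : ℝ))⁻¹ • lam n) := fun n i j hij =>
    mul_le_mul_of_nonneg_left (hlam_anti n hij) (by positivity)
  have hl₁0 : ∀ (n : ℕ) i, 0 ≤ ((√(n : ℝ))⁻¹ • lam n) i := fun n i =>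
    mul_nonneg (by positivity) (hlam_nonneg n i)
  have hlim := tendsto_pi_nhds.1 hlam_lim
  have hl : Antitone l := fun i j hij =>
    le_of_tendsto_of_tendsto' (hlim j) (hlim i) fun n => hl₁ n hij
  have hl0 : ∀ i, 0 ≤ l i := fun i => ge_of_tendsto' (hlim i) fun n => hl₁0 n i
  have hXm : ∀ i, AEMeasurable (X i) μ := fun i => (hX_ident i).aemeasurable_fst
  have hindep := indepFun_pair hXε 0
  have hgram := ae_tendsto_empiricalGram hX_indep hX_ident hX_L2 hX_mean hX_cov
  have hscore := ae_tendsto_smul_empiricalScore hX_indep hX_ident hX_L2 hε_indep hε_ident hε_L2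
    hε_mean hXε
  have hclt : TendstoInDistribution
      (fun n ω => empiricalScore n (fun i => X i ω) fun i => ε i ω) atTop W (fun _ => μ) μ₁ :=
    tendstoInDistribution_inv_sqrt_smul_sum (posSemidef_smul_sq hC σ) hW
      (memLp_smul_of_indepFun hX_L2 hε_L2 hindep)
      (integral_smul_eq_zero_of_indepFun hX_L2 hε_L2 hindep hε_mean)
      (variance_inner_smul_of_indepFun hX_L2 hX_mean hε_L2 hindep hε_mean hX_cov hε_var)
      (iIndepFun_smul hX_indep hXm hε_indep (fun i => (hε_ident i).aemeasurable_fst) hXε)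
      (identDistrib_smul hX_ident hε_ident hXε)
  have hgram_meas : ∀ n i j, AEMeasurable (fun ω => empiricalGram n (fun i => X i ω) i j) μ :=
    fun n i j => by
      simp only [empiricalGram_apply]
      refine (Finset.aemeasurable_fun_sum _ fun k _ => ?_).div_const _
      exact (by fun_prop : Measurable fun x : EuclideanSpace ℝ (Fin p) =>
        x i * x j).comp_aemeasurable (hXm k)
  obtain ⟨hBm, hBlim⟩ := tendsto_measure_residualSlack_nonpos (b := β₀) (τ := τ) (s := s) hC hσ hW
    hclt hgram_meas hgram hlam_lim
  have hlimit : μ₁.real {ω | ∀ t, residualSlack β₀ τ s (W ω,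
      (fun i j => (C * patternInv β₀ C) i j), l) t ≤ 0} =
      μ₁.real {ω | slopeResidual β₀ C (signedPermVec τ s l) (W ω) ∈
        subdifferential (slopeNorm l) 0} := by
    simp only [residualSlack_nonpos_iff hs hl hl0 hC]
  -- The two events agree almost surely, which needs no measurability of `uhat`.
  have huhat : μ₁.real {ω | uhat ω ∈ patternSpan β₀} =
      μ₁.real {ω | slopeResidual β₀ C (signedPermVec τ s l) (W ω) ∈
        subdifferential (slopeNorm l) 0} := by
    refine measureReal_congr ?_
    filter_upwards [hu] with ω hω
    exact propext (mem_patternSpan_iff_slopeResidual_mem hb hl hl0 hC hω)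
  refine ⟨?_, ?_, ?_⟩
  · rw [huhat, ← hlimit]
    refine tendsto_real_of_ae_eventually_iff
      (fun n => (hβ_meas n).nullMeasurableSet_preimage (measurableSet_slopePattern_eq β₀)) hBm ?_
      hBlim
    filter_upwards [ae_all_iff.2 hβ, hgram, hscore] with ω hmin hg hsc
    -- For almost every sample and large `n`, the Gram matrix is positive definite and the candidate
    -- has the right pattern, so the two events coincide.
    filter_upwards [eventually_ne_atTop 0,
      eventually_posDef hC hg fun n => transpose_empiricalGram n _,
      eventually_samePattern_add_smul_patternInv (b := β₀) (s := s) τ hC hg hsc hlam_lim]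
      with n hn hpd hsmall
    rw [Set.mem_preimage, Set.mem_ofPred_eq, slopePattern_eq_iff]
    exact (samePattern_estimator_iff hn (fun i => hy i ω) (hmin n) hb (hl₁ n) (hl₁0 n) hpd
      hsmall).trans (residualSlack_nonpos_iff hs (hl₁ n) (hl₁0 n) hpd _).symm
  · have hmeas : MeasurableSet (subdifferential (slopeNorm l) 0) := by
      -- Finitely many half-spaces suffice, hence measurability.
      have : subdifferential (slopeNorm l) 0 =
          ⋂ t : Fin p → SignType, {v | ⟪v, signVec t⟫ ≤ slopeNorm l (signVec t)} := by
        ext v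
        simp [mem_subdifferential_slopeNorm_zero_iff_signVec]
      rw [this]
      exact MeasurableSet.iInter fun t => measurableSet_le (by fun_prop) measurable_const
    have hlaw := hasLaw_slopeResidual (b := β₀) hC hW Λ₀
    rw [← hP, hΛ₀, hΛ] at hlaw
    rw [hΛ₀] at hZ
    rw [huhat, measureReal_def, measureReal_def]
    congr 1
    have h1 := Measure.map_apply_of_aemeasurable hlaw.aemeasurable hmeas
    have h2 := Measure.map_apply_of_aemeasurable hZ.aemeasurable hmeas
    rw [hlaw.map_eq] at h1
    rw [hZ.map_eq] at h2
    exact h1.symm.trans h2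
  · rw [hP]
    exact toEuclideanCLM_patternProjection hC
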